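/- Let $n\ge 1$ and let $X_1,\dots,X_n$ be a martingale difference sequence with respect to a filtration $\mathcal F_0\subseteq\dots\subseteq\mathcal F_n$ on a probability space, that is, each $X_k$ is integrable and $\mathcal F_k$-measurable and $\mathbb E(X_k\mid\mathcal F_{k-1})=0$ almost surely for $1\le k\le n$. Assume $\mathbb E|X_k|^3<\infty$ for $1\le k\le n$. Put $$S_n=\sum_{k=1}^n X_k,\qquad \sigma_k^2=\mathbb E(X_k^2\mid\mathcal F_{k-1}),\qquad V_n^2=\sum_{k=1}^n\sigma_k^2,\qquad s_n^2=\operatorname{Var}S_n,$$ and assume $s_n>0$. Suppose that there are constants $\beta$ and $\delta$ such that, almost surely, $$\mathbb E\bigl(|X_k|^3\mid\mathcal F_{k-1}\bigr)\le\min\bigl(\beta,\ \delta\sigma_k^2\bigr),\qquad 1\le k\le n.$$ Then $$d_{\mathrm W}\bigl(\mathcal L(S_n/s_n),\mathrm N(0,1)\bigr)\le 1.5\,\Bigl(\mathbb E\Bigl|\frac{V_n^2}{s_n^2}-1\Bigr|\Bigr)^{1/2}+\frac{3n\,\max(1.6\,\beta^{1/3},\delta)\,\bigl(s_n^2/n+1.4\,\beta^{2/3}\bigr)(1+\log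 n)}{s_n^3}+\frac{2}{\sqrt n},$$ where $d_{\mathrm W}(F,G)=\sup_h\bigl|\int h\,dF-\int h\,dG\bigr|$ is the Wasserstein distance, the supremum being over all $1$-Lipschitz functions $h:\mathbb R\to\mathbb R$. -/

import Mathlib

open MeasureTheory ProbabilityTheory
open scoped ENNReal NNReal

noncomputable section

namespace MartingaleCLT

variable {Ω : Type*} {m0 : MeasurableSpace Ω}

/-- The Wasserstein distance of two distributions on the real line: the supremum of
`|∫ h dP - ∫ h dQ|` over all `1`-Lipschitz functions `h`, as an element of `[0, ∞]`.
It is meant for distributions with finite first moments, for which all these integrals exist. -/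
def wassersteinDist (P Q : Measure ℝ) : ℝ≥0∞ :=
  ⨆ (h : ℝ → ℝ) (_ : LipschitzWith 1 h), ENNReal.ofReal |∫ x, h x ∂P - ∫ x, h x ∂Q|

/-- `X 1, …, X n` is a martingale difference sequence with respect to `ℱ 0 ⊆ … ⊆ ℱ n`.
(Nothing is required of `X k` for other indices `k`, and `ℱ k` with `k > n` plays no role.) -/
structure IsMartingaleDiffSeq (X : ℕ → Ω → ℝ) (ℱ : Filtration ℕ m0) (μ : Measure Ω)
    (n : ℕ) : Prop where
  adapted : ∀ k ∈ Finset.Icc 1 n, Measurable[ℱ k] (X k)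
  integrable : ∀ k ∈ Finset.Icc 1 n, Integrable (X k) μ
  condExp_eq_zero : ∀ k ∈ Finset.Icc 1 n, μ[X k | ℱ (k - 1)] =ᵐ[μ] 0

/-- The martingale `S_n = X_1 + ⋯ + X_n`. -/
def partialSum (X : ℕ → Ω → ℝ) (n : ℕ) (ω : Ω) : ℝ :=
  ∑ k ∈ Finset.Icc 1 n, X k ω

/-- The conditional variance `σ_k² = E(X_k² | ℱ_{k-1})`, for `k ≥ 1`. -/
def sigmaSq (X : ℕ → Ω → ℝ) (ℱ : Filtration ℕ m0) (μ : Measure Ω) (k : ℕ) : Ω → ℝ :=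
  μ[fun ω => X k ω ^ 2 | ℱ (k - 1)]

/-- `V_n² = σ_1² + ⋯ + σ_n²`. -/
def VSq (X : ℕ → Ω → ℝ) (ℱ : Filtration ℕ m0) (μ : Measure Ω) (n : ℕ) (ω : Ω) : ℝ :=
  ∑ k ∈ Finset.Icc 1 n, sigmaSq X ℱ μ k ω

/-- `s_n`, the standard deviation of `S_n`, so that `s_n² = Var S_n`. -/
def stdDev (X : ℕ → Ω → ℝ) (μ : Measure Ω) (n : ℕ) : ℝ :=
  √(variance (partialSum X n) μ)

end MartingaleCLT

end

/-! ### Moments of the standard normal law. -/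

namespace MartingaleCLT

/-! The proof is Lindeberg's replacement method for a stopped martingale, with Gaussian smoothing
whose variance is random. Put `c = s_n²` and let `q i` be the conditional variances, all at most `B
= β^(2/3)` by conditional Jensen. The step `i` is kept only while `q 0 + ⋯ + q i ≤ c`, a predictable
condition, and `R_k` denotes the part of `c` not yet used by the kept steps.

For a `1`-Lipschitz `f`, the quantity `E f(S'_k + √(R_k + e + B) Z)`, with `S'` the stopped
martingale, moves a Gaussian of variance `c + e + B` (`k = 0`) to a slightly smoothed `S'_n` (`k =
n`). In one step a martingale difference replaces a Gaussian of the same conditional variance, so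
the terms of order one and two cancel. The third derivative after smoothing with variance `t` is of
order `1/t`, which gives the error `2δ q/(R_{k+1} + e + B)` (`integral_gaussSmooth_step_le`). These
errors add up like a Riemann sum of `dr/r`, hence only to a logarithm (`sum_div_remainder_le`).

It remains to undo the stopping and the smoothing. By orthogonality `E(S - S')² = E R_n`, and `E R_n
≤ E|V_n² - c|/2 + B` (`remainder_le_add`), so both cost square roots of this quantity and of `e +
B`; see `integral_sub_gaussSmooth_le`. The choice `e = s_n²/n` and elementary estimates
(`error_terms_le`) give the stated bound. -/

lemma integrable_exp_abs_gaussian (c : ℝ) :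
    Integrable (fun z => Real.exp (c * |z|)) (gaussianReal 0 1) := by
  refine Integrable.mono' ((integrable_exp_mul_gaussianReal (μ := 0) (v := 1) c).add
    (integrable_exp_mul_gaussianReal (-c))) (by fun_prop) (ae_of_all _ fun z => ?_)
  rw [Real.norm_eq_abs, Real.abs_exp, Pi.add_apply]
  rcases abs_cases z with ⟨h, -⟩ | ⟨h, -⟩ <;> rw [h]
  · linarith [Real.exp_pos (-c * z)]
  · rw [mul_neg, ← neg_mul]; linarith [Real.exp_pos (c * z)]

lemma integrable_abs_gaussian : Integrable (fun z : ℝ => |z|) (gaussianReal 0 1) := by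
  refine Integrable.mono' (integrable_exp_abs_gaussian 1) (by fun_prop) (ae_of_all _ fun z => ?_)
  rw [Real.norm_eq_abs, abs_abs, one_mul]
  linarith [Real.add_one_le_exp |z|]

lemma integrable_sq_gaussian : Integrable (fun z : ℝ => z ^ 2) (gaussianReal 0 1) :=
  (memLp_id_gaussianReal 2).integrable_sq

lemma integral_sq_gaussian : ∫ z : ℝ, z ^ 2 ∂(gaussianReal 0 1) = 1 := by
  have h := variance_fun_id_gaussianReal (μ := 0) (v := 1)
  rw [variance_eq_integral measurable_id'.aemeasurable] at h
  simpa using h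

lemma integral_abs_gaussian_le : ∫ z : ℝ, |z| ∂(gaussianReal 0 1) ≤ 1 := by
  have h : ∫ z : ℝ, |z| ∂(gaussianReal 0 1) ≤ ∫ z : ℝ, (z ^ 2 + 1) / 2 ∂(gaussianReal 0 1) := by
    refine integral_mono integrable_abs_gaussian
      ((integrable_sq_gaussian.add (integrable_const 1)).div_const 2) fun z => ?_
    change |z| ≤ (z ^ 2 + 1) / 2
    nlinarith [sq_nonneg (|z| - 1), sq_abs z]
  rw [integral_div, integral_add integrable_sq_gaussian (integrable_const 1),
    integral_sq_gaussian] at h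
  simpa using h

lemma integrable_abs_cube_gaussian :
    Integrable (fun z : ℝ => |z| ^ 3) (gaussianReal 0 1) := by
  refine Integrable.mono' (integrable_exp_abs_gaussian 3) (by fun_prop) (ae_of_all _ fun z => ?_)
  rw [Real.norm_eq_abs, abs_of_nonneg (by positivity), show 3 * |z| = (3 : ℕ) * |z| by norm_num,
    Real.exp_nat_mul]
  gcongr
  linarith [Real.add_one_le_exp |z|]

/-- Cubing `u ≤ exp (u - 1)` at `u = 2|z|/3` reduces the moment to the moment generating function at
`±2`. The result is at most `27/8`; the cruder `5` is what makes the constant in the replacement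
step a round `2`. -/
lemma integral_abs_cube_gaussian_le : ∫ z : ℝ, |z| ^ 3 ∂(gaussianReal 0 1) ≤ 5 := by
  have hp (z : ℝ) : |z| ^ 3 ≤ 27 / 8 * Real.exp (-3) *
      (Real.exp (2 * z) + Real.exp (-2 * z)) := by
    have h1 : |z| ≤ 3 / 2 * Real.exp (2 / 3 * |z| - 1) := by
      linarith [Real.add_one_le_exp (2 / 3 * |z| - 1)]
    have h2 : |z| ^ 3 ≤ 27 / 8 * (Real.exp (-3) * Real.exp (2 * |z|)) := by
      calc |z| ^ 3 ≤ (3 / 2 * Real.exp (2 / 3 * |z| - 1)) ^ 3 := by gcongr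
        _ = 27 / 8 * (Real.exp (-3) * Real.exp (2 * |z|)) := by
          rw [mul_pow, ← Real.exp_nat_mul, ← Real.exp_add]; norm_num; ring_nf
    have h3 : Real.exp (2 * |z|) ≤ Real.exp (2 * z) + Real.exp (-2 * z) := by
      rcases abs_cases z with ⟨h, -⟩ | ⟨h, -⟩ <;> rw [h]
      · linarith [Real.exp_pos (-2 * z)]
      · rw [mul_neg, ← neg_mul]; linarith [Real.exp_pos (2 * z)]
    rw [mul_assoc]
    exact h2.trans (by gcongr)
  have hm (t : ℝ) : ∫ z, Real.exp (t * z) ∂(gaussianReal 0 1) = Real.exp (t ^ 2 / 2) := by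
    have := congrFun (mgf_fun_id_gaussianReal (μ := 0) (v := 1)) t
    simpa [mgf] using this
  have hi (t : ℝ) := integrable_exp_mul_gaussianReal (μ := 0) (v := 1) t
  have h := integral_mono integrable_abs_cube_gaussian
    (((hi 2).add (hi (-2))).const_mul (27 / 8 * Real.exp (-3))) hp
  simp only [Pi.add_apply] at h
  rw [integral_const_mul, integral_add (hi 2) (hi (-2)), hm, hm, mul_assoc, mul_add,
    ← Real.exp_add, ← Real.exp_add] at h
  have h1 : Real.exp (-3 + 2 ^ 2 / 2) ≤ 1 / 2 := by
    rw [show (-3 + 2 ^ 2 / 2 : ℝ) = -1 by norm_num, Real.exp_neg, inv_eq_one_div]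
    gcongr
    linarith [Real.add_one_le_exp 1]
  have h2 : Real.exp (-3 + (-2) ^ 2 / 2) ≤ 1 / 2 := by simpa using h1
  linarith

/-! ### Gaussian smoothing of Lipschitz functions and Taylor expansion. -/

/-- The Cameron–Martin formula: a shift of the variable becomes an exponential weight on the
density. -/
lemma integral_gaussian_add (f : ℝ → ℝ) (d : ℝ) :
    ∫ z, f (z + d) ∂(gaussianReal 0 1)
      = ∫ z, f z * Real.exp (d * z - d ^ 2 / 2) ∂(gaussianReal 0 1) := by
  rw [integral_gaussianReal_eq_integral_smul one_ne_zero,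
    integral_gaussianReal_eq_integral_smul one_ne_zero,
    ← integral_sub_right_eq_self (fun z => gaussianPDFReal 0 1 z • f (z + d)) d]
  refine integral_congr_ae (ae_of_all _ fun z => ?_)
  simp only [gaussianPDFReal, sub_add_cancel, smul_eq_mul]
  rw [mul_comm (f z), ← mul_assoc, mul_assoc _ (Real.exp _) (Real.exp _), ← Real.exp_add]
  congr 3
  simp
  ring

lemma abs_le_of_lipschitz {f : ℝ → ℝ} {L : ℝ≥0} (hf : LipschitzWith L f) (x y : ℝ) :
    |f x - f y| ≤ L * |x - y| := by
  simpa [Real.dist_eq] using hf.dist_le_mul x y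

lemma abs_comp_le {f : ℝ → ℝ} {L : ℝ≥0} (hf : LipschitzWith L f) (x r z : ℝ) :
    |f (x + r * z)| ≤ (|f x| + L * |r|) * Real.exp |z| := by
  have h1 := abs_le_of_lipschitz hf (x + r * z) x
  rw [add_sub_cancel_left, abs_mul] at h1
  have h2 : |f (x + r * z)| ≤ |f x| + L * (|r| * |z|) := by
    have := abs_sub_abs_le_abs_sub (f (x + r * z)) (f x)
    linarith
  have h3 : 1 ≤ Real.exp |z| := Real.one_le_exp (abs_nonneg z)
  have h4 : |z| ≤ Real.exp |z| := by linarith [Real.add_one_le_exp |z|]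
  calc _ ≤ |f x| * 1 + L * |r| * |z| := by linarith
    _ ≤ |f x| * Real.exp |z| + L * |r| * Real.exp |z| := by gcongr
    _ = _ := by ring

lemma integrable_comp_gaussian {f : ℝ → ℝ} {L : ℝ≥0} (hf : LipschitzWith L f) (x r : ℝ) :
    Integrable (fun z => f (x + r * z)) (gaussianReal 0 1) := by
  have := hf.continuous
  refine Integrable.mono' ((integrable_exp_abs_gaussian 1).const_mul (|f x| + L * |r|))
    (by fun_prop) (ae_of_all _ fun z => ?_)
  simpa using abs_comp_le hf x r z

lemma integrable_comp_mul_gaussian {f : ℝ → ℝ} {L : ℝ≥0} (hf : LipschitzWith L f) (x r : ℝ) :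
    Integrable (fun z => f (x + r * z) * z) (gaussianReal 0 1) := by
  have := hf.continuous
  refine Integrable.mono' ((integrable_exp_abs_gaussian 2).const_mul (|f x| + L * |r|))
    (by fun_prop) (ae_of_all _ fun z => ?_)
  rw [Real.norm_eq_abs, abs_mul]
  have h4 : |z| ≤ Real.exp |z| := by linarith [Real.add_one_le_exp |z|]
  calc _ ≤ (|f x| + L * |r|) * Real.exp |z| * Real.exp |z| := by
        gcongr; exact abs_comp_le hf x r z
    _ = _ := by rw [mul_assoc, ← Real.exp_add]; ring_nf

/-- The derivative of `x ↦ E f (x + r Z)`, with `Z` standard normal. -/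
noncomputable def smoothDeriv (f : ℝ → ℝ) (r x : ℝ) : ℝ :=
  (∫ z, f (x + r * z) * z ∂(gaussianReal 0 1)) / r

/-- Since `f` need not be differentiable, moving `x` to `y` is read as shifting the Gaussian
variable by `(y - x)/r`, and the derivative falls on the smooth weight. -/
lemma hasDerivAt_smooth {f : ℝ → ℝ} {L : ℝ≥0} (hf : LipschitzWith L f) {r : ℝ} (hr : r ≠ 0)
    (x : ℝ) :
    HasDerivAt (fun x => ∫ z, f (x + r * z) ∂(gaussianReal 0 1)) (smoothDeriv f r x) x := by
  have hc := hf.continuous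
  have key : HasDerivAt
      (fun d => ∫ z, f (x + r * z) * Real.exp (d * z - d ^ 2 / 2) ∂(gaussianReal 0 1))
      (∫ z, f (x + r * z) * (Real.exp (0 * z - 0 ^ 2 / 2) * (z - 0)) ∂(gaussianReal 0 1)) 0 := by
    refine (hasDerivAt_integral_of_dominated_loc_of_deriv_le
      (F := fun d z => f (x + r * z) * Real.exp (d * z - d ^ 2 / 2))
      (F' := fun d z => f (x + r * z) * (Real.exp (d * z - d ^ 2 / 2) * (z - d)))
      -- One factor `exp |z|` each for `f`, for the weight and for `z - d`, as `|d| < 1`.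
      (bound := fun z => (|f x| + L * |r|) * Real.exp (3 * |z|))
      (Metric.ball_mem_nhds 0 one_pos) (Filter.Eventually.of_forall fun d => by fun_prop) ?_
      (by fun_prop) (ae_of_all _ fun z d hd => ?_)
      ((integrable_exp_abs_gaussian 3).const_mul _) (ae_of_all _ fun z d _ => ?_)).2
    · simpa using integrable_comp_gaussian hf x r
    · rw [Metric.mem_ball, dist_zero_right, Real.norm_eq_abs] at hd
      rw [Real.norm_eq_abs, abs_mul, abs_mul, Real.abs_exp]
      have h1 : Real.exp (d * z - d ^ 2 / 2) ≤ Real.exp |z| := by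
        apply Real.exp_le_exp.2
        have : d * z ≤ |d| * |z| := by rw [← abs_mul]; exact le_abs_self _
        nlinarith [abs_nonneg z, sq_nonneg d]
      have h2 : |z - d| ≤ Real.exp |z| := by
        have := abs_sub z d
        linarith [Real.add_one_le_exp |z|]
      calc _ ≤ (|f x| + L * |r|) * Real.exp |z| * (Real.exp |z| * Real.exp |z|) := by
            gcongr; exact abs_comp_le hf x r z
        _ = _ := by rw [mul_assoc, ← Real.exp_add, ← Real.exp_add]; ring_nf
    · have h : HasDerivAt (fun d : ℝ => d * z - d ^ 2 / 2) (z - d) d := by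
        have h1 : HasDerivAt (fun d : ℝ => d * z) (1 * z) d := (hasDerivAt_id d).mul_const z
        have h2 : HasDerivAt (fun d : ℝ => d ^ 2 / 2) ((2 : ℕ) * d ^ 1 / 2) d :=
          (hasDerivAt_pow 2 d).div_const 2
        exact (h1.sub h2).congr_deriv (by simp)
      exact (h.exp).const_mul _
  have e (y : ℝ) : ∫ z, f (y + r * z) ∂(gaussianReal 0 1)
      = ∫ z, f (x + r * z) * Real.exp (((y - x) / r) * z - ((y - x) / r) ^ 2 / 2)
        ∂(gaussianReal 0 1) := by
    rw [← integral_gaussian_add (fun z => f (x + r * z)) ((y - x) / r)]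
    congr 1 with z
    congr 1
    field_simp
    ring
  have h0 : HasDerivAt (fun y => (y - x) / r) (1 / r) x :=
    ((hasDerivAt_id x).sub_const x).div_const r
  have := HasDerivAt.comp_of_eq x key h0 (by simp)
  rw [funext e]
  refine this.congr_deriv ?_
  rw [smoothDeriv]
  simp [div_eq_mul_inv]

lemma hasDerivAt_smooth_of_hasDerivAt {f f' : ℝ → ℝ} {L : ℝ≥0} (hf : LipschitzWith L f)
    (hd : ∀ x, HasDerivAt f (f' x) x) (hf' : Continuous f') (r x : ℝ) :
    HasDerivAt (fun x => ∫ z, f (x + r * z) ∂(gaussianReal 0 1))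
      (∫ z, f' (x + r * z) ∂(gaussianReal 0 1)) x := by
  have hc := hf.continuous
  refine (hasDerivAt_integral_of_dominated_loc_of_deriv_le
      (F := fun x z => f (x + r * z)) (F' := fun x z => f' (x + r * z))
      (bound := fun z => (L : ℝ)) (Metric.ball_mem_nhds x one_pos)
      (Filter.Eventually.of_forall fun d => by fun_prop) (integrable_comp_gaussian hf x r)
      (by fun_prop) (ae_of_all _ fun z y _ => ?_)
      (integrable_const _) (ae_of_all _ fun z y _ => ?_)).2
  · rw [← (hd _).deriv]
    exact norm_deriv_le_of_lipschitz hf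
  · exact HasDerivAt.comp_add_const y (r * z) (hd _)

lemma lipschitz_smooth {f : ℝ → ℝ} {L : ℝ≥0} (hf : LipschitzWith L f) (r : ℝ) :
    LipschitzWith L (fun x => ∫ z, f (x + r * z) ∂(gaussianReal 0 1)) := by
  refine LipschitzWith.of_dist_le_mul fun x y => ?_
  rw [Real.dist_eq, Real.dist_eq, ← integral_sub (integrable_comp_gaussian hf x r)
    (integrable_comp_gaussian hf y r)]
  have := norm_integral_le_of_norm_le_const (μ := gaussianReal 0 1)
    (f := fun z => f (x + r * z) - f (y + r * z)) (C := L * |x - y|) (ae_of_all _ fun z => by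
      simpa using abs_le_of_lipschitz hf (x + r * z) (y + r * z))
  simpa using this

/-- Each smoothing at scale `r` thus buys one derivative for a factor `1/r`, because `E|Z| ≤ 1`. -/
lemma lipschitz_smoothDeriv {f : ℝ → ℝ} {L : ℝ≥0} (hf : LipschitzWith L f) {r : ℝ≥0}
    (hr : r ≠ 0) : LipschitzWith (L / r) (smoothDeriv f r) := by
  refine LipschitzWith.of_dist_le_mul fun x y => ?_
  have hr0 : (0 : ℝ) < r := by positivity
  rw [Real.dist_eq, Real.dist_eq, smoothDeriv, smoothDeriv, ← sub_div,
    ← integral_sub (integrable_comp_mul_gaussian hf x r) (integrable_comp_mul_gaussian hf y r),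
    abs_div, abs_of_pos hr0, NNReal.coe_div, div_mul_eq_mul_div]
  gcongr
  have h1 : ‖∫ z, (f (x + r * z) * z - f (y + r * z) * z) ∂(gaussianReal 0 1)‖
      ≤ ∫ z, L * |x - y| * |z| ∂(gaussianReal 0 1) := by
    refine norm_integral_le_of_norm_le (integrable_abs_gaussian.const_mul _)
      (ae_of_all _ fun z => ?_)
    rw [← sub_mul, Real.norm_eq_abs, abs_mul]
    gcongr
    simpa using abs_le_of_lipschitz hf (x + r * z) (y + r * z)
  rw [integral_const_mul] at h1
  calc _ ≤ _ := h1
    _ ≤ L * |x - y| * 1 := by gcongr; exact integral_abs_gaussian_le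
    _ = _ := mul_one _

lemma abs_smoothDeriv_le {f : ℝ → ℝ} {L : ℝ≥0} (hf : LipschitzWith L f) {r : ℝ} (hr : r ≠ 0)
    (x : ℝ) : |smoothDeriv f r x| ≤ L := by
  rw [← (hasDerivAt_smooth hf hr x).deriv]
  exact norm_deriv_le_of_lipschitz (lipschitz_smooth hf r)

/-- No third derivative is needed: the Lipschitz bound on `g2` is integrated twice by comparing
derivatives. -/
lemma taylor_two_le {g g1 g2 : ℝ → ℝ} {K : ℝ≥0} (h1 : ∀ x, HasDerivAt g (g1 x) x)
    (h2 : ∀ x, HasDerivAt g1 (g2 x) x) (hK : LipschitzWith K g2) (x : ℝ) {d : ℝ} (hd : 0 ≤ d) :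
    g (x + d) - g x - g1 x * d - g2 x * d ^ 2 / 2 ≤ K * d ^ 3 / 6 := by
  have p1 (e : ℝ) : HasDerivAt (fun d => g (x + d)) (g1 (x + e)) e :=
    HasDerivAt.comp_const_add x e (h1 _)
  have p2 (e : ℝ) : HasDerivAt (fun d => g1 (x + d)) (g2 (x + e)) e :=
    HasDerivAt.comp_const_add x e (h2 _)
  have q1 (c e : ℝ) : HasDerivAt (fun d : ℝ => c * d) c e := by
    simpa using (hasDerivAt_id e).const_mul c
  have q2 (c e : ℝ) : HasDerivAt (fun d : ℝ => c * d ^ 2 / 2) (c * e) e := by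
    exact (((hasDerivAt_pow 2 e).const_mul c).div_const 2).congr_deriv (by push_cast; ring)
  have q3 (c e : ℝ) : HasDerivAt (fun d : ℝ => c * d ^ 3 / 6) (c * e ^ 2 / 2) e := by
    exact (((hasDerivAt_pow 3 e).const_mul c).div_const 6).congr_deriv (by push_cast; ring)
  have s1 (e : ℝ) : HasDerivAt (fun d => g1 (x + d) - g1 x - g2 x * d)
      (g2 (x + e) - g2 x) e := ((p2 e).sub_const _).sub (q1 _ e)
  have s0 (e : ℝ) : HasDerivAt (fun d => g (x + d) - g x - g1 x * d - g2 x * d ^ 2 / 2)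
      (g1 (x + e) - g1 x - g2 x * e) e := (((p1 e).sub_const _).sub (q1 _ e)).sub (q2 _ e)
  have step1 (e : ℝ) (he : 0 ≤ e) : g1 (x + e) - g1 x - g2 x * e ≤ K * e ^ 2 / 2 := by
    refine image_le_of_deriv_right_le_deriv_boundary (a := 0) (b := e)
      (f := fun d => g1 (x + d) - g1 x - g2 x * d) (f' := fun e => g2 (x + e) - g2 x)
      (B := fun d : ℝ => K * d ^ 2 / 2) (B' := fun d => K * d)
      (fun y _ => (s1 y).continuousAt.continuousWithinAt)
      (fun y _ => (s1 y).hasDerivWithinAt) (by simp) (by fun_prop)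
      (fun y _ => (q2 _ y).hasDerivWithinAt) (fun y hy => ?_) ⟨he, le_rfl⟩
    have := abs_le_of_lipschitz hK (x + y) x
    rw [add_sub_cancel_left, abs_of_nonneg hy.1] at this
    exact (le_abs_self _).trans this
  refine image_le_of_deriv_right_le_deriv_boundary (a := 0) (b := d)
      (f := fun d => g (x + d) - g x - g1 x * d - g2 x * d ^ 2 / 2)
      (f' := fun e => g1 (x + e) - g1 x - g2 x * e)
      (B := fun d : ℝ => K * d ^ 3 / 6) (B' := fun d => K * d ^ 2 / 2)
      (fun y _ => (s0 y).continuousAt.continuousWithinAt)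
      (fun y _ => (s0 y).hasDerivWithinAt) (by simp) (by fun_prop)
      (fun y _ => (q3 _ y).hasDerivWithinAt) (fun y hy => step1 y hy.1) ⟨hd, le_rfl⟩

lemma abs_taylor_two_le {g g1 g2 : ℝ → ℝ} {K : ℝ≥0} (h1 : ∀ x, HasDerivAt g (g1 x) x)
    (h2 : ∀ x, HasDerivAt g1 (g2 x) x) (hK : LipschitzWith K g2) (x d : ℝ) :
    |g (x + d) - g x - g1 x * d - g2 x * d ^ 2 / 2| ≤ K * |d| ^ 3 / 6 := by
  have pos {g g1 g2 : ℝ → ℝ} (h1 : ∀ x, HasDerivAt g (g1 x) x)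
      (h2 : ∀ x, HasDerivAt g1 (g2 x) x) (hK : LipschitzWith K g2) (x : ℝ) {d : ℝ}
      (hd : 0 ≤ d) :
      |g (x + d) - g x - g1 x * d - g2 x * d ^ 2 / 2| ≤ K * d ^ 3 / 6 := by
    refine abs_le'.2 ⟨taylor_two_le h1 h2 hK x hd, ?_⟩
    have := taylor_two_le (fun x => (h1 x).neg) (fun x => (h2 x).neg) hK.neg x hd
    simp only [Pi.neg_apply] at this
    linarith
  rcases le_total 0 d with hd | hd
  · simpa [abs_of_nonneg hd] using pos h1 h2 hK x hd
  · have n1 (y : ℝ) : HasDerivAt (fun x => g (-x)) (-(g1 (-y))) y := by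
      exact ((h1 (-y)).comp y (hasDerivAt_neg y)).congr_deriv (by ring)
    have n2 (y : ℝ) : HasDerivAt (fun x => -(g1 (-x))) (g2 (-y)) y := by
      exact ((h2 (-y)).comp y (hasDerivAt_neg y)).neg.congr_deriv (by ring)
    have n3 : LipschitzWith K (fun x => g2 (-x)) := by
      have := hK.comp LipschitzWith.id.neg
      rwa [mul_one] at this
    have := pos n1 n2 n3 (-x) (neg_nonneg.2 hd)
    rw [abs_of_nonpos hd]
    convert this using 2
    ring_nf

end MartingaleCLT

/-! ### The Gaussian semigroup and its expansions in space and in variance. -/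

namespace MartingaleCLT

/-- `E f (x + √t Z)`, with `Z` standard normal. -/
noncomputable def gaussSmooth (f : ℝ → ℝ) (t x : ℝ) : ℝ :=
  ∫ z, f (x + √t * z) ∂(gaussianReal 0 1)

lemma gaussSmooth_eq (f : ℝ → ℝ) (hf : Continuous f) {t : ℝ≥0} (x : ℝ) :
    gaussSmooth f t x = ∫ y, f (x + y) ∂(gaussianReal 0 t) := by
  have h := gaussianReal_map_const_mul (μ := 0) (v := 1) (√(t : ℝ))
  have e : NNReal.mk (√(t : ℝ) ^ 2) (sq_nonneg _) * 1 = t := by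
    ext; simp [Real.sq_sqrt t.coe_nonneg]
  rw [mul_zero, e] at h
  rw [← h, integral_map (by fun_prop) (by fun_prop), gaussSmooth]

lemma gaussSmooth_add {f : ℝ → ℝ} {L : ℝ≥0} (hf : LipschitzWith L f) {s t : ℝ} (hs : 0 ≤ s)
    (ht : 0 ≤ t) (x : ℝ) :
    gaussSmooth f (s + t) x = ∫ z, gaussSmooth f t (x + √s * z) ∂(gaussianReal 0 1) := by
  lift s to ℝ≥0 using hs
  lift t to ℝ≥0 using ht
  have hc := hf.continuous
  have hc2 : Continuous (gaussSmooth f t) := (lipschitz_smooth hf _).continuous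
  have hi : Integrable (fun y => f (x + y)) (gaussianReal 0 s ∗ gaussianReal 0 t) := by
    rw [gaussianReal_conv_gaussianReal]
    refine Integrable.mono' (g := fun y => |f x| + L * |y|) ?_ (by fun_prop)
      (ae_of_all _ fun y => ?_)
    · have : Integrable (fun y : ℝ => y) (gaussianReal (0 + 0) (s + t)) :=
        memLp_one_iff_integrable.1 (memLp_id_gaussianReal 1)
      exact (integrable_const _).add (this.abs.const_mul _)
    · have := abs_le_of_lipschitz hf (x + y) x
      rw [add_sub_cancel_left] at this
      have h2 := abs_sub_abs_le_abs_sub (f (x + y)) (f x)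
      rw [Real.norm_eq_abs]
      linarith
  have h1 := gaussSmooth_eq f hc (t := s + t) x
  rw [NNReal.coe_add] at h1
  change _ = gaussSmooth (gaussSmooth f t) s x
  rw [h1, gaussSmooth_eq _ hc2, show (0 : ℝ) = 0 + 0 by simp, ← gaussianReal_conv_gaussianReal]
  rw [Measure.conv, integrable_map_measure (by fun_prop) (by fun_prop)] at hi
  rw [Measure.conv, integral_map (by fun_prop) (by fun_prop),
    integral_prod (fun p : ℝ × ℝ => f (x + (p.1 + p.2))) hi, add_zero]
  congr 1 with y
  rw [gaussSmooth_eq f hc]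
  simp [add_assoc]

lemma abs_gaussSmooth_sub_le {f : ℝ → ℝ} (hf : LipschitzWith 1 f) (t t' x x' : ℝ) :
    |gaussSmooth f t x - gaussSmooth f t' x'| ≤ |x - x'| + |√t - √t'| := by
  have h := norm_integral_le_of_norm_le
    (f := fun z => f (x + √t * z) - f (x' + √t' * z))
    (g := fun z => |x - x'| + |√t - √t'| * |z|) (μ := gaussianReal 0 1)
    ((integrable_const _).add (integrable_abs_gaussian.const_mul _)) (ae_of_all _ fun z => by
      have := abs_le_of_lipschitz hf (x + √t * z) (x' + √t' * z)
      rw [NNReal.coe_one, one_mul] at this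
      rw [← abs_mul, Real.norm_eq_abs]
      refine this.trans ?_
      rw [show x + √t * z - (x' + √t' * z) = (x - x') + (√t - √t') * z by ring]
      exact abs_add_le _ _)
  rw [integral_sub (integrable_comp_gaussian hf _ _) (integrable_comp_gaussian hf _ _),
    integral_add (integrable_const _) (integrable_abs_gaussian.const_mul _),
    integral_const_mul] at h
  rw [Real.norm_eq_abs] at h
  refine h.trans ?_
  simp only [integral_const, probReal_univ, one_smul]
  nlinarith [integral_abs_gaussian_le, abs_nonneg (√t - √t')]

lemma gaussSmooth_zero (f : ℝ → ℝ) (x : ℝ) : gaussSmooth f 0 x = f x := by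
  simp [gaussSmooth]

lemma continuous_gaussSmooth {f : ℝ → ℝ} (hf : LipschitzWith 1 f) :
    Continuous (fun p : ℝ × ℝ => gaussSmooth f p.1 p.2) := by
  rw [continuous_iff_continuousAt]
  intro p
  rw [ContinuousAt, tendsto_iff_dist_tendsto_zero]
  have hc : Continuous (fun q : ℝ × ℝ => |q.2 - p.2| + |√q.1 - √p.1|) := by fun_prop
  refine squeeze_zero (g := fun q : ℝ × ℝ => |q.2 - p.2| + |√q.1 - √p.1|)
    (fun _ => dist_nonneg) (fun q => ?_) (by simpa using hc.tendsto p)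
  rw [Real.dist_eq]
  exact abs_gaussSmooth_sub_le hf q.1 p.1 q.2 p.2

lemma measurable_smoothDeriv {f : ℝ → ℝ} (hf : Continuous f) :
    Measurable (fun p : ℝ × ℝ => smoothDeriv f p.1 p.2) := by
  have h : StronglyMeasurable
      (fun q : (ℝ × ℝ) × ℝ => f (q.1.2 + q.1.1 * q.2) * q.2) := by
    apply Continuous.stronglyMeasurable; fun_prop
  exact (h.integral_prod_right' (ν := gaussianReal 0 1)).measurable.div measurable_fst

/-- The spatial derivative of `gaussSmooth f`. -/
noncomputable def gaussDeriv (f : ℝ → ℝ) (t x : ℝ) : ℝ :=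
  ∫ z, smoothDeriv f √(t / 2) (x + √(t / 2) * z) ∂(gaussianReal 0 1)

/-- The second spatial derivative of `gaussSmooth f`. -/
noncomputable def gaussDeriv₂ (f : ℝ → ℝ) (t x : ℝ) : ℝ :=
  smoothDeriv (smoothDeriv f √(t / 2)) √(t / 2) x

lemma measurable_gaussDeriv {f : ℝ → ℝ} (hf : Continuous f) :
    Measurable (fun p : ℝ × ℝ => gaussDeriv f p.1 p.2) := by
  have h : StronglyMeasurable (fun q : (ℝ × ℝ) × ℝ =>
      smoothDeriv f √(q.1.1 / 2) (q.1.2 + √(q.1.1 / 2) * q.2)) := by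
    apply Measurable.stronglyMeasurable
    exact (measurable_smoothDeriv hf).comp (g := fun p : ℝ × ℝ => smoothDeriv f p.1 p.2)
      (f := fun q : (ℝ × ℝ) × ℝ => (√(q.1.1 / 2), q.1.2 + √(q.1.1 / 2) * q.2)) (by fun_prop)
  exact (h.integral_prod_right' (ν := gaussianReal 0 1)).measurable

lemma measurable_gaussDeriv₂ {f : ℝ → ℝ} (hf : Continuous f) :
    Measurable (fun p : ℝ × ℝ => gaussDeriv₂ f p.1 p.2) := by
  have h : StronglyMeasurable (fun q : (ℝ × ℝ) × ℝ =>
      smoothDeriv f √(q.1.1 / 2) (q.1.2 + √(q.1.1 / 2) * q.2) * q.2) := by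
    apply Measurable.stronglyMeasurable
    refine Measurable.mul ?_ measurable_snd
    exact (measurable_smoothDeriv hf).comp (g := fun p : ℝ × ℝ => smoothDeriv f p.1 p.2)
      (f := fun q : (ℝ × ℝ) × ℝ => (√(q.1.1 / 2), q.1.2 + √(q.1.1 / 2) * q.2)) (by fun_prop)
  exact (h.integral_prod_right' (ν := gaussianReal 0 1)).measurable.div (by fun_prop)

lemma abs_gaussDeriv_le {f : ℝ → ℝ} (hf : LipschitzWith 1 f) {t : ℝ} (ht : 0 < t) (x : ℝ) :
    |gaussDeriv f t x| ≤ 1 := by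
  have hr : √(t / 2) ≠ 0 := by positivity
  have := norm_integral_le_of_norm_le_const (μ := gaussianReal 0 1)
    (f := fun z => smoothDeriv f √(t / 2) (x + √(t / 2) * z)) (C := 1) (ae_of_all _ fun z => by
      simpa using abs_smoothDeriv_le hf hr (x + √(t / 2) * z))
  simpa [gaussDeriv] using this

lemma lipschitz_smoothDeriv_sqrt {f : ℝ → ℝ} {L : ℝ≥0} (hf : LipschitzWith L f) {t : ℝ}
    (ht : 0 < t) : LipschitzWith (L / (√(t / 2)).toNNReal) (smoothDeriv f √(t / 2)) := by
  have hr : 0 < √(t / 2) := by positivity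
  have := lipschitz_smoothDeriv hf (r := (√(t / 2)).toNNReal) (by simpa using ht)
  rwa [Real.coe_toNNReal _ hr.le] at this

lemma abs_gaussDeriv₂_le {f : ℝ → ℝ} (hf : LipschitzWith 1 f) {t : ℝ} (ht : 0 < t) (x : ℝ) :
    |gaussDeriv₂ f t x| ≤ 1 / √(t / 2) := by
  have hr : √(t / 2) ≠ 0 := by positivity
  have := abs_smoothDeriv_le (lipschitz_smoothDeriv_sqrt hf ht) hr x
  rwa [NNReal.coe_div, Real.coe_toNNReal _ (Real.sqrt_nonneg _), NNReal.coe_one] at this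

/-- Smoothing with variance `t` is smoothing twice with variance `t/2`. Each half contributes a
factor `1/√(t/2)`, so the second derivative is `2/t`-Lipschitz, and `(2/t)/6 = 1/(3t)`. -/
lemma abs_gaussSmooth_taylor_le {f : ℝ → ℝ} (hf : LipschitzWith 1 f) {t : ℝ} (ht : 0 < t)
    (x d : ℝ) :
    |gaussSmooth f t (x + d) - gaussSmooth f t x - gaussDeriv f t x * d
      - gaussDeriv₂ f t x * d ^ 2 / 2| ≤ |d| ^ 3 / (3 * t) := by
  have hr : 0 < √(t / 2) := by positivity
  have e : gaussSmooth f t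
      = fun x => ∫ z, gaussSmooth f (t / 2) (x + √(t / 2) * z) ∂(gaussianReal 0 1) := by
    ext x
    rw [← gaussSmooth_add hf (by positivity) (by positivity), add_halves]
  have h := hasDerivAt_smooth hf hr.ne'
  have hl := lipschitz_smoothDeriv_sqrt hf ht
  have h1 (x : ℝ) : HasDerivAt (gaussSmooth f t) (gaussDeriv f t x) x := by
    rw [e]
    exact hasDerivAt_smooth_of_hasDerivAt (lipschitz_smooth hf _) h hl.continuous _ x
  have h2 (x : ℝ) : HasDerivAt (gaussDeriv f t) (gaussDeriv₂ f t x) x :=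
    hasDerivAt_smooth hl hr.ne' x
  refine (abs_taylor_two_le h1 h2 (lipschitz_smoothDeriv_sqrt hl ht) x d).trans (le_of_eq ?_)
  have hs : √(t / 2) * √(t / 2) = t / 2 := Real.mul_self_sqrt (by positivity)
  rw [NNReal.coe_div, NNReal.coe_div, Real.coe_toNNReal _ hr.le, NNReal.coe_one, div_div, hs]
  field_simp
  ring

/-- The additional variance `v` is an average over the shift `√v Z`. Integrating the spatial Taylor
expansion kills the linear term and leaves `v/2` times the second derivative, so no derivative in
`t` is used. -/
lemma abs_gaussSmooth_add_sub_le {f : ℝ → ℝ} (hf : LipschitzWith 1 f) {t v : ℝ} (ht : 0 < t)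
    (hv : 0 ≤ v) (x : ℝ) :
    |gaussSmooth f (t + v) x - gaussSmooth f t x - gaussDeriv₂ f t x * v / 2|
      ≤ 5 * √v ^ 3 / (3 * t) := by
  have hi : Integrable (fun z : ℝ => z) (gaussianReal 0 1) :=
    memLp_one_iff_integrable.1 (memLp_id_gaussianReal 1)
  have i1 : Integrable (fun z => gaussSmooth f t (x + √v * z)) (gaussianReal 0 1) :=
    integrable_comp_gaussian (lipschitz_smooth hf _) x _
  have i2 : Integrable (fun z => gaussDeriv f t x * √v * z) (gaussianReal 0 1) :=
    hi.const_mul _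
  have i3 : Integrable (fun z => gaussDeriv₂ f t x * v / 2 * z ^ 2) (gaussianReal 0 1) :=
    integrable_sq_gaussian.const_mul _
  have e : gaussSmooth f (t + v) x - gaussSmooth f t x - gaussDeriv₂ f t x * v / 2
      = ∫ z, (gaussSmooth f t (x + √v * z) - gaussSmooth f t x - gaussDeriv f t x * √v * z
        - gaussDeriv₂ f t x * v / 2 * z ^ 2) ∂(gaussianReal 0 1) := by
    have j1 : Integrable (fun z => gaussSmooth f t (x + √v * z) - gaussSmooth f t x)
      (gaussianReal 0 1) := i1.sub (integrable_const _)
    have j2 : Integrable (fun z => gaussSmooth f t (x + √v * z) - gaussSmooth f t x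
      - gaussDeriv f t x * √v * z) (gaussianReal 0 1) := j1.sub i2
    rw [integral_sub j2 i3, integral_sub j1 i2, integral_sub i1 (integrable_const _),
      integral_const_mul, integral_const_mul, integral_sq_gaussian, integral_id_gaussianReal,
      add_comm t v, gaussSmooth_add hf hv ht.le]
    simp
  rw [e, ← Real.norm_eq_abs]
  refine (norm_integral_le_of_norm_le (g := fun z => √v ^ 3 / (3 * t) * |z| ^ 3)
    (integrable_abs_cube_gaussian.const_mul _) (ae_of_all _ fun z => ?_)).trans ?_
  · have := abs_gaussSmooth_taylor_le hf ht x (√v * z)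
    rw [abs_mul, abs_of_nonneg (Real.sqrt_nonneg v), mul_pow (√v) z, Real.sq_sqrt hv] at this
    rw [Real.norm_eq_abs]
    convert this using 1 <;> ring_nf
  · rw [integral_const_mul]
    calc _ ≤ √v ^ 3 / (3 * t) * 5 := by gcongr; exact integral_abs_cube_gaussian_le
      _ = _ := by ring

lemma gaussSmooth_step {f : ℝ → ℝ} (hf : LipschitzWith 1 f) {t v : ℝ} (ht : 0 < t)
    (hv : 0 ≤ v) (x d : ℝ) :
    gaussSmooth f t (x + d) - gaussSmooth f (t + v) x
      ≤ gaussDeriv f t x * d + gaussDeriv₂ f t x / 2 * (d ^ 2 - v)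
        + (|d| ^ 3 + 5 * √v ^ 3) / (3 * t) := by
  have h1 := (abs_le.1 (abs_gaussSmooth_taylor_le hf ht x d)).2
  have h2 := (abs_le.1 (abs_gaussSmooth_add_sub_le hf ht hv x)).1
  rw [add_div]
  linarith

end MartingaleCLT

/-! ### Stopping by accumulated variance: pathwise estimates. -/

namespace MartingaleCLT

section Stopping

variable {c B : ℝ} {q : ℕ → ℝ}

/-- The indicator of `q 0 + ⋯ + q i ≤ c`. -/
noncomputable def stopInd (c : ℝ) (q : ℕ → ℝ) (i : ℕ) : ℝ :=
  if ∑ j ∈ Finset.range (i + 1), q j ≤ c then 1 else 0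

/-- What is left of `c` after the steps of `q` allowed by `stopInd`. -/
noncomputable def remainder (c : ℝ) (q : ℕ → ℝ) (k : ℕ) : ℝ :=
  c - ∑ i ∈ Finset.range k, stopInd c q i * q i

lemma stopInd_eq_zero_or_one (c : ℝ) (q : ℕ → ℝ) (i : ℕ) :
    stopInd c q i = 0 ∨ stopInd c q i = 1 := by
  unfold stopInd; split_ifs <;> simp

lemma stopInd_nonneg (c : ℝ) (q : ℕ → ℝ) (i : ℕ) : 0 ≤ stopInd c q i := by
  rcases stopInd_eq_zero_or_one c q i with h | h <;> simp [h]

lemma stopInd_le_one (c : ℝ) (q : ℕ → ℝ) (i : ℕ) : stopInd c q i ≤ 1 := by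
  rcases stopInd_eq_zero_or_one c q i with h | h <;> simp [h]

lemma remainder_zero (c : ℝ) (q : ℕ → ℝ) : remainder c q 0 = c := by simp [remainder]

lemma remainder_succ_add (c : ℝ) (q : ℕ → ℝ) (k : ℕ) :
    remainder c q (k + 1) + stopInd c q k * q k = remainder c q k := by
  rw [remainder, remainder, Finset.sum_range_succ]; ring

lemma remainder_nonneg (hc : 0 ≤ c) (hq : ∀ i, 0 ≤ q i) (k : ℕ) : 0 ≤ remainder c q k := by
  induction k with
  | zero => simpa [remainder_zero] using hc
  | succ k ih =>
    by_cases h : ∑ j ∈ Finset.range (k + 1), q j ≤ c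
    · rw [remainder, sub_nonneg]
      refine le_trans (Finset.sum_le_sum fun i _ => ?_) h
      exact mul_le_of_le_one_left (hq i) (stopInd_le_one c q i)
    · have := remainder_succ_add c q k
      rw [stopInd, if_neg h] at this
      linarith

lemma remainder_le (hq : ∀ i, 0 ≤ q i) (k : ℕ) : remainder c q k ≤ c :=
  sub_le_self _ (Finset.sum_nonneg fun i _ => mul_nonneg (stopInd_nonneg c q i) (hq i))

/-- If the total does not exceed `c`, nothing is stopped and the remainder is `c - ∑ q`. Otherwise
the first forbidden step exceeds what was left, so the remainder is at most `B`. The positive part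
of `c - ∑ q` is written as half of modulus plus value because the value has mean zero in the
application, which saves a factor `2`. -/
lemma remainder_le_add (hc : 0 ≤ c) (hq : ∀ i, 0 ≤ q i) (hB : ∀ i, q i ≤ B) (k : ℕ) :
    remainder c q k ≤ (|∑ i ∈ Finset.range k, q i - c|
      + (c - ∑ i ∈ Finset.range k, q i)) / 2 + B := by
  have hB0 : 0 ≤ B := (hq 0).trans (hB 0)
  have key : (∑ i ∈ Finset.range k, q i ≤ c →
      remainder c q k = c - ∑ i ∈ Finset.range k, q i) ∧
      (c < ∑ i ∈ Finset.range k, q i → remainder c q k ≤ B) := by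
    induction k with
    | zero => simp [remainder_zero, not_lt.2 hc]
    | succ k ih =>
      have hr := remainder_succ_add c q k
      have hs := Finset.sum_range_succ q k
      constructor
      · intro h
        rw [stopInd, if_pos h] at hr
        have := ih.1 (by linarith [hq k])
        linarith
      · intro h
        rw [stopInd, if_neg (not_le.2 h)] at hr
        rcases le_or_gt (∑ i ∈ Finset.range k, q i) c with h' | h'
        · have := ih.1 h'
          linarith [hB k]
        · linarith [ih.2 h']
  rcases le_or_gt (∑ i ∈ Finset.range k, q i) c with h | h
  · rw [key.1 h, abs_of_nonpos (by linarith)]; linarith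
  · rw [abs_of_nonneg (by linarith)]; linarith [key.2 h]

/-- A step uses at most `B`, so `R_{i+1} + e + B ≥ R_i + e`, and `1 - 1/x ≤ log x` bounds each term
by a difference of logarithms, which telescopes. This is why `B` is part of the smoothing variance.
-/
lemma sum_div_remainder_le (hc : 0 ≤ c) (hq : ∀ i, 0 ≤ q i) (hB : ∀ i, q i ≤ B) {e : ℝ}
    (he : 0 < e) (k : ℕ) :
    ∑ i ∈ Finset.range k, stopInd c q i * q i / (remainder c q (i + 1) + (e + B))
      ≤ Real.log ((c + e) / e) := by
  have hB0 : 0 ≤ B := (hq 0).trans (hB 0)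
  have hpos (i : ℕ) : 0 < remainder c q i + e := by linarith [remainder_nonneg hc hq i]
  have step (i : ℕ) : stopInd c q i * q i / (remainder c q (i + 1) + (e + B))
      ≤ Real.log (remainder c q i + e) - Real.log (remainder c q (i + 1) + e) := by
    have hr := remainder_succ_add c q i
    have hd : stopInd c q i * q i ≤ B :=
      (mul_le_of_le_one_left (hq i) (stopInd_le_one c q i)).trans (hB i)
    have hd0 : 0 ≤ stopInd c q i * q i := mul_nonneg (stopInd_nonneg c q i) (hq i)
    rw [← Real.log_div (hpos i).ne' (hpos (i + 1)).ne']
    refine le_trans ?_ (Real.one_sub_inv_le_log_of_pos (div_pos (hpos i) (hpos (i + 1))))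
    rw [inv_div, one_sub_div (hpos i).ne']
    rw [show remainder c q i + e - (remainder c q (i + 1) + e) = stopInd c q i * q i by
      linarith]
    exact div_le_div_of_nonneg_left hd0 (hpos i) (by linarith)
  refine (Finset.sum_le_sum fun i _ => step i).trans ?_
  rw [Finset.sum_range_sub', remainder_zero, Real.log_div (by positivity) he.ne']
  gcongr
  linarith [remainder_nonneg hc hq k]

end Stopping

/-! ### Conditional expectations and one replacement step. -/

section Conditioning

variable {Ω : Type*} {m m0 : MeasurableSpace Ω} {μ : Measure Ω}

lemma integrable_mul_of_bounded {W Z : Ω → ℝ} {C : ℝ}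
    (hW : AEStronglyMeasurable W μ) (hC : ∀ ω, |W ω| ≤ C) (hZ : Integrable Z μ) :
    Integrable (fun ω => W ω * Z ω) μ :=
  hZ.bdd_mul hW (ae_of_all _ hC)

variable [IsProbabilityMeasure μ]

lemma integral_mul_eq_of_bounded (hm : m ≤ m0) {W Z : Ω → ℝ} {C : ℝ}
    (hW : StronglyMeasurable[m] W) (hC : ∀ ω, |W ω| ≤ C) (hZ : Integrable Z μ) :
    ∫ ω, W ω * Z ω ∂μ = ∫ ω, W ω * (μ[Z | m]) ω ∂μ := by
  rw [← integral_condExp hm]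
  exact integral_congr_ae (condExp_stronglyMeasurable_mul_of_bound hm hW hZ C
    (ae_of_all _ hC))

lemma integral_mul_eq_zero (hm : m ≤ m0) {M Y : Ω → ℝ} (hM : StronglyMeasurable[m] M)
    (hM2 : MemLp M 2 μ) (hY : MemLp Y 2 μ) (h0 : μ[Y | m] =ᵐ[μ] 0) :
    ∫ ω, M ω * Y ω ∂μ = 0 := by
  rw [← integral_condExp hm]
  have := condExp_mul_of_stronglyMeasurable_left hM (hM2.integrable_mul hY)
    (hY.integrable one_le_two)
  refine (integral_congr_ae (g := fun _ => (0 : ℝ)) ?_).trans (integral_zero _ _)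
  filter_upwards [this, h0] with ω h h'
  rw [show (fun ω => M ω * Y ω) = M * Y from rfl, h, Pi.mul_apply, h']
  simp

/-- Conditional Jensen for the convex function `x ^ (3/2)`. -/
lemma sqrt_cube_condExp_le (hm : m ≤ m0) {Y : Ω → ℝ} (hY : MemLp Y 3 μ) :
    ∀ᵐ ω ∂μ, √((μ[fun ω => Y ω ^ 2 | m]) ω) ^ 3 ≤ (μ[fun ω => |Y ω| ^ 3 | m]) ω := by
  have i2 : Integrable (fun ω => Y ω ^ 2) μ := (hY.mono_exponent (by norm_num)).integrable_sq
  have i3 : Integrable (fun ω => |Y ω| ^ 3) μ := by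
    simpa using hY.integrable_norm_pow (by norm_num)
  have e (y : ℝ) : (y ^ 2) ^ (3 / 2 : ℝ) = |y| ^ 3 := by
    rw [← sq_abs, ← Real.rpow_natCast_mul (abs_nonneg y), ← Real.rpow_natCast]
    norm_num
  have h := ConvexOn.map_condExp_le (μ := μ) hm (φ := fun x : ℝ => x ^ (3 / 2 : ℝ))
    (s := Set.Ici 0) (f := fun ω => Y ω ^ 2) (convexOn_rpow (by norm_num))
    ((Real.continuous_rpow_const (by norm_num)).lowerSemicontinuous.lowerSemicontinuousOn _)
    (ae_of_all _ fun ω => Set.mem_Ici.2 (sq_nonneg _)) isClosed_Ici i2 (by simpa [Function.comp_def, e] using i3)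
  have h0 : 0 ≤ᵐ[μ] μ[fun ω => Y ω ^ 2 | m] := condExp_nonneg (ae_of_all _ fun ω => sq_nonneg _)
  filter_upwards [h, h0] with ω h h0
  simp only [Function.comp_def, e] at h
  convert h using 1
  rw [Real.sqrt_eq_rpow, ← Real.rpow_mul_natCast h0]
  norm_num

lemma integral_abs_le_sqrt {Z : Ω → ℝ} (hZ : MemLp Z 2 μ) :
    ∫ ω, |Z ω| ∂μ ≤ √(∫ ω, Z ω ^ 2 ∂μ) := by
  refine Real.le_sqrt_of_sq_le ?_
  have h := variance_nonneg |Z| μ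
  rw [variance_eq_sub hZ.abs] at h
  simp only [Pi.pow_apply, Pi.abs_apply, sq_abs] at h
  linarith

lemma integrable_gaussSmooth {f : ℝ → ℝ} (hf : LipschitzWith 1 f) {T M : Ω → ℝ} {C : ℝ}
    (hT : Measurable T) (hTC : ∀ ω, T ω ≤ C) (hM : Integrable M μ) :
    Integrable (fun ω => gaussSmooth f (T ω) (M ω)) μ := by
  refine Integrable.mono' (g := fun ω => |f 0| + (|M ω| + √C))
    ((integrable_const _).add (hM.abs.add (integrable_const _)))
    ((continuous_gaussSmooth hf).comp_aestronglyMeasurable₂ hT.aestronglyMeasurable hM.1)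
    (ae_of_all _ fun ω => ?_)
  have h := abs_gaussSmooth_sub_le hf (T ω) 0 (M ω) 0
  rw [gaussSmooth_zero, Real.sqrt_zero, sub_zero, sub_zero, abs_of_nonneg (Real.sqrt_nonneg _)]
    at h
  have h2 := abs_sub_abs_le_abs_sub (gaussSmooth f (T ω) (M ω)) (f 0)
  have h3 := Real.sqrt_le_sqrt (hTC ω)
  rw [Real.norm_eq_abs]
  linarith

/-- One step of the Lindeberg replacement. -/
lemma integral_gaussSmooth_step_le (hm : m ≤ m0) {f : ℝ → ℝ} (hf : LipschitzWith 1 f)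
    {Y q M T J : Ω → ℝ} {α B C δ : ℝ} (hα : 0 < α) (hY3 : MemLp Y 3 μ)
    (hY0 : μ[Y | m] =ᵐ[μ] 0) (hYq : μ[fun ω => Y ω ^ 2 | m] =ᵐ[μ] q)
    (hYδ : ∀ᵐ ω ∂μ, (μ[fun ω => |Y ω| ^ 3 | m]) ω ≤ δ * q ω)
    (hq : Measurable[m] q) (hq0 : ∀ ω, 0 ≤ q ω) (hqB : ∀ ω, q ω ≤ B)
    (hM : Measurable[m] M) (hMi : Integrable M μ) (hT : Measurable[m] T) (hT0 : ∀ ω, 0 ≤ T ω)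
    (hTC : ∀ ω, T ω ≤ C) (hJ : Measurable[m] J) (hJ01 : ∀ ω, J ω = 0 ∨ J ω = 1) :
    ∫ ω, gaussSmooth f (T ω + α) (M ω + J ω * Y ω) ∂μ
      - ∫ ω, gaussSmooth f (T ω + J ω * q ω + α) (M ω) ∂μ
      ≤ 2 * δ * ∫ ω, J ω * q ω / (T ω + α) ∂μ := by
  have i1 : Integrable Y μ := hY3.integrable (by norm_num)
  have i2 : Integrable (fun ω => Y ω ^ 2) μ := (hY3.mono_exponent (by norm_num)).integrable_sq
  have i3 : Integrable (fun ω => |Y ω| ^ 3) μ := by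
    simpa using hY3.integrable_norm_pow (by norm_num)
  have hJ1 (ω) : |J ω| ≤ 1 := by rcases hJ01 ω with h | h <;> simp [h]
  have hJ0 (ω) : 0 ≤ J ω := by rcases hJ01 ω with h | h <;> simp [h]
  have hJl (ω) : J ω ≤ 1 := (le_abs_self _).trans (hJ1 ω)
  have ht (ω) : 0 < T ω + α := by linarith [hT0 ω]
  have hcf := hf.continuous
  have iq : Integrable q μ := Integrable.of_bound (hq.mono hm le_rfl).aestronglyMeasurable B
    (ae_of_all _ fun ω => by simpa [abs_of_nonneg (hq0 ω)] using hqB ω)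
  -- The weights of `Y`, `Y ^ 2 - q` and the cubic errors in `gaussSmooth_step`. They are measurable
  -- before the step and bounded because `α > 0`, so they can be pulled out of conditional
  -- expectations.
  set w1 : Ω → ℝ := fun ω => gaussDeriv f (T ω + α) (M ω) * J ω with hw1
  set w2 : Ω → ℝ := fun ω => gaussDeriv₂ f (T ω + α) (M ω) * J ω / 2 with hw2
  set w3 : Ω → ℝ := fun ω => J ω / (3 * (T ω + α)) with hw3
  have m1 : Measurable[m] w1 :=
    ((measurable_gaussDeriv hcf).comp (f := fun ω => (T ω + α, M ω))
      ((hT.add_const α).prodMk hM)).mul hJ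
  have m2 : Measurable[m] w2 :=
    (((measurable_gaussDeriv₂ hcf).comp (f := fun ω => (T ω + α, M ω))
      ((hT.add_const α).prodMk hM)).mul hJ).div_const 2
  have m3 : Measurable[m] w3 := hJ.div ((hT.add_const α).const_mul 3)
  have b1 (ω) : |w1 ω| ≤ 1 := by
    rw [hw1, abs_mul]
    exact mul_le_one₀ (abs_gaussDeriv_le hf (ht ω) _) (abs_nonneg _) (hJ1 ω)
  have b2 (ω) : |w2 ω| ≤ 1 / √(α / 2) := by
    have h1 : |gaussDeriv₂ f (T ω + α) (M ω)| ≤ 1 / √(α / 2) := by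
      refine (abs_gaussDeriv₂_le hf (ht ω) _).trans ?_
      gcongr
      linarith [hT0 ω]
    rw [hw2, abs_div, abs_mul, abs_two]
    have := mul_le_mul h1 (hJ1 ω) (abs_nonneg _) (by positivity)
    have h0 : 0 ≤ 1 / √(α / 2) := by positivity
    linarith
  have w3n (ω) : 0 ≤ w3 ω := div_nonneg (hJ0 ω) (by linarith [ht ω])
  have b3 (ω) : |w3 ω| ≤ 1 / (3 * α) := by
    rw [abs_of_nonneg (w3n ω)]
    exact div_le_div₀ zero_le_one (hJl ω) (by positivity) (by linarith [hT0 ω])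
  have s1 := (m1.mono hm le_rfl).aestronglyMeasurable (μ := μ)
  have s2 := (m2.mono hm le_rfl).aestronglyMeasurable (μ := μ)
  have s3 := (m3.mono hm le_rfl).aestronglyMeasurable (μ := μ)
  have c1 := integrable_mul_of_bounded s1 b1 i1
  have c2 := integrable_mul_of_bounded s2 b2 i2
  have c2q := integrable_mul_of_bounded s2 b2 iq
  have c3 := integrable_mul_of_bounded s3 b3 i3
  have c3q := integrable_mul_of_bounded s3 b3 iq
  have v1 : ∫ ω, w1 ω * Y ω ∂μ = 0 := by
    rw [integral_mul_eq_of_bounded hm m1.stronglyMeasurable b1 i1]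
    refine (integral_congr_ae (g := fun _ => (0 : ℝ)) ?_).trans (integral_zero _ _)
    filter_upwards [hY0] with ω h
    simp [h]
  have v2 : ∫ ω, w2 ω * Y ω ^ 2 ∂μ = ∫ ω, w2 ω * q ω ∂μ := by
    rw [integral_mul_eq_of_bounded hm m2.stronglyMeasurable b2 i2]
    refine integral_congr_ae ?_
    filter_upwards [hYq] with ω h
    rw [h]
  have v3 : ∫ ω, w3 ω * |Y ω| ^ 3 ∂μ ≤ δ * ∫ ω, w3 ω * q ω ∂μ := by
    rw [integral_mul_eq_of_bounded hm m3.stronglyMeasurable b3 i3, ← integral_const_mul]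
    refine integral_mono_ae (integrable_mul_of_bounded s3 b3 integrable_condExp)
      (c3q.const_mul δ) ?_
    filter_upwards [hYδ] with ω h
    have := mul_le_mul_of_nonneg_left h (w3n ω)
    linarith
  -- The Gaussian replacement obeys the same third moment bound, so the total error is `(1 + 5) * δ
  -- * q / (3 * t) = 2 * δ * q / t` with `t = T + α`.
  have hcube : ∀ᵐ ω ∂μ, √(q ω) ^ 3 ≤ δ * q ω := by
    filter_upwards [hYδ, hYq, sqrt_cube_condExp_le hm hY3] with ω h h' h''
    rw [h'] at h''
    exact h''.trans h
  have point : ∀ᵐ ω ∂μ, gaussSmooth f (T ω + α) (M ω + J ω * Y ω)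
      - gaussSmooth f (T ω + J ω * q ω + α) (M ω)
      ≤ w1 ω * Y ω + (w2 ω * Y ω ^ 2 - w2 ω * q ω)
        + (w3 ω * |Y ω| ^ 3 + 5 * δ * (w3 ω * q ω)) := by
    filter_upwards [hcube] with ω h
    have hstep := gaussSmooth_step hf (ht ω) (mul_nonneg (hJ0 ω) (hq0 ω)) (M ω) (J ω * Y ω)
    rw [show T ω + J ω * q ω + α = T ω + α + J ω * q ω by ring]
    refine hstep.trans ?_
    rcases hJ01 ω with hJω | hJω
    · simp [hw1, hw2, hw3, hJω]
    · simp only [hw1, hw2, hw3, hJω, one_mul, mul_one]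
      have : 5 * √(q ω) ^ 3 / (3 * (T ω + α)) ≤ 5 * (δ * q ω) / (3 * (T ω + α)) := by
        have := ht ω
        gcongr
      rw [add_div]
      have e1 : 1 / (3 * (T ω + α)) * |Y ω| ^ 3 = |Y ω| ^ 3 / (3 * (T ω + α)) := by ring
      have e2 : 5 * δ * (1 / (3 * (T ω + α)) * q ω) = 5 * (δ * q ω) / (3 * (T ω + α)) := by
        ring
      rw [e1, e2]
      linarith
  have hqm := hq.mono hm le_rfl
  have hTm := hT.mono hm le_rfl
  have hJm := hJ.mono hm le_rfl
  have g1 : Integrable (fun ω => gaussSmooth f (T ω + α) (M ω + J ω * Y ω)) μ :=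
    integrable_gaussSmooth hf (C := C + α) (hTm.add_const α) (fun ω => by linarith [hTC ω])
      (hMi.add (integrable_mul_of_bounded hJm.aestronglyMeasurable hJ1 i1))
  have g2 : Integrable (fun ω => gaussSmooth f (T ω + J ω * q ω + α) (M ω)) μ :=
    integrable_gaussSmooth hf (C := C + B + α) ((hTm.add (hJm.mul hqm)).add_const α)
      (fun ω => by
        have := mul_le_of_le_one_left (hq0 ω) (hJl ω)
        linarith [hTC ω, hqB ω]) hMi
  have c2' : Integrable (fun ω => w2 ω * Y ω ^ 2 - w2 ω * q ω) μ := c2.sub c2q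
  have c12 : Integrable (fun ω => w1 ω * Y ω + (w2 ω * Y ω ^ 2 - w2 ω * q ω)) μ := c1.add c2'
  have c33 : Integrable (fun ω => w3 ω * |Y ω| ^ 3 + 5 * δ * (w3 ω * q ω)) μ :=
    c3.add (c3q.const_mul _)
  rw [← integral_sub g1 g2]
  refine (integral_mono_ae (g1.sub g2) (c12.add c33) point).trans ?_
  simp only [Pi.add_apply]
  rw [integral_add c12 c33, integral_add c1 c2', integral_sub c2 c2q, v1, v2,
    integral_add c3 (c3q.const_mul _), integral_const_mul]
  have e : ∫ ω, w3 ω * q ω ∂μ = (∫ ω, J ω * q ω / (T ω + α) ∂μ) / 3 := by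
    rw [← integral_div]
    refine integral_congr_ae (ae_of_all _ fun ω => ?_)
    have := (ht ω).ne'
    simp only [hw3]
    field_simp
  rw [e] at v3 ⊢
  linarith

end Conditioning

end MartingaleCLT

/-! ### The stopped martingale and the comparison with a Gaussian. -/

namespace MartingaleCLT

lemma sqrt_add_le_add_sqrt {x y : ℝ} (hx : 0 ≤ x) (hy : 0 ≤ y) : √(x + y) ≤ √x + √y := by
  refine Real.sqrt_le_iff.2 ⟨by positivity, ?_⟩
  have := mul_nonneg (Real.sqrt_nonneg x) (Real.sqrt_nonneg y)
  nlinarith [Real.sq_sqrt hx, Real.sq_sqrt hy]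

/-- Martingale differences `Y 0, …, Y (n - 1)` with third moments, whose conditional variances are
bounded functions `q i`, and whose conditional third moments are at most `δ * q i`. -/
structure HasCondMoments {Ω : Type*} {m0 : MeasurableSpace Ω} (μ : Measure Ω)
    (ℱ : Filtration ℕ m0) (Y q : ℕ → Ω → ℝ) (n : ℕ) (B δ : ℝ) : Prop where
  meas : ∀ i < n, Measurable[ℱ (i + 1)] (Y i)
  memLp : ∀ i < n, MemLp (Y i) 3 μ
  condExp_eq_zero : ∀ i < n, μ[Y i | ℱ i] =ᵐ[μ] 0
  condExp_sq : ∀ i < n, μ[fun ω => Y i ω ^ 2 | ℱ i] =ᵐ[μ] q i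
  condExp_cube_le : ∀ i < n, ∀ᵐ ω ∂μ, (μ[fun ω => |Y i ω| ^ 3 | ℱ i]) ω ≤ δ * q i ω
  q_meas : ∀ i, Measurable[ℱ i] (q i)
  q_nonneg : ∀ i ω, 0 ≤ q i ω
  q_le : ∀ i ω, q i ω ≤ B

namespace HasCondMoments

variable {Ω : Type*} {m0 : MeasurableSpace Ω} {μ : Measure Ω}
  {ℱ : Filtration ℕ m0} {Y q J : ℕ → Ω → ℝ} {n : ℕ} {B δ : ℝ}

lemma measurable_transform (h : HasCondMoments μ ℱ Y q n B δ)
    (hJ : ∀ i, Measurable[ℱ i] (J i)) {k : ℕ} (hk : k ≤ n) :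
    Measurable[ℱ k] (fun ω => ∑ i ∈ Finset.range k, J i ω * Y i ω) := by
  refine Finset.measurable_fun_sum _ fun i hi => ?_
  have hik : i < k := Finset.mem_range.1 hi
  exact ((hJ i).mono (ℱ.mono hik.le) le_rfl).mul
    ((h.meas i (hik.trans_le hk)).mono (ℱ.mono hik) le_rfl)

lemma measurable_stopInd (h : HasCondMoments μ ℱ Y q n B δ) (c : ℝ) (i : ℕ) :
    Measurable[ℱ i] (fun ω => stopInd c (fun j => q j ω) i) := by
  refine Measurable.ite (measurableSet_le (Finset.measurable_fun_sum _ fun j hj => ?_)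
    measurable_const) measurable_const measurable_const
  exact (h.q_meas j).mono (ℱ.mono (Nat.lt_succ_iff.1 (Finset.mem_range.1 hj))) le_rfl

lemma measurable_remainder (h : HasCondMoments μ ℱ Y q n B δ) (c : ℝ) (i : ℕ) :
    Measurable[ℱ i] (fun ω => remainder c (fun j => q j ω) (i + 1)) := by
  refine Measurable.const_sub (Finset.measurable_fun_sum _ fun j hj => ?_) c
  exact ((h.measurable_stopInd c j).mul (h.q_meas j)).mono
    (ℱ.mono (Nat.lt_succ_iff.1 (Finset.mem_range.1 hj))) le_rfl

variable [IsProbabilityMeasure μ]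

lemma integrable_q (h : HasCondMoments μ ℱ Y q n B δ) (i : ℕ) : Integrable (q i) μ :=
  Integrable.of_bound ((h.q_meas i).mono (ℱ.le i) le_rfl).aestronglyMeasurable B
    (ae_of_all _ fun ω => by simpa [abs_of_nonneg (h.q_nonneg i ω)] using h.q_le i ω)

lemma memLp_mul (h : HasCondMoments μ ℱ Y q n B δ)
    (hJ : ∀ i, Measurable[ℱ i] (J i)) (hJ1 : ∀ i ω, |J i ω| ≤ 1) {i : ℕ} (hi : i < n) :
    MemLp (fun ω => J i ω * Y i ω) 2 μ := by
  have hY := (h.memLp i hi).mono_exponent (q := 3) (p := 2) (by norm_num)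
  refine hY.mono (((hJ i).mono (ℱ.le i) le_rfl).aestronglyMeasurable.mul hY.1)
    (ae_of_all _ fun ω => ?_)
  rw [norm_mul]
  exact mul_le_of_le_one_left (norm_nonneg _) (hJ1 i ω)

lemma memLp_transform (h : HasCondMoments μ ℱ Y q n B δ)
    (hJ : ∀ i, Measurable[ℱ i] (J i)) (hJ1 : ∀ i ω, |J i ω| ≤ 1) {k : ℕ} (hk : k ≤ n) :
    MemLp (fun ω => ∑ i ∈ Finset.range k, J i ω * Y i ω) 2 μ :=
  memLp_finsetSum _ fun _ hi => h.memLp_mul hJ hJ1 ((Finset.mem_range.1 hi).trans_le hk)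

/-- Orthogonality of martingale differences. -/
lemma integral_transform_sq (h : HasCondMoments μ ℱ Y q n B δ)
    (hJ : ∀ i, Measurable[ℱ i] (J i)) (hJ1 : ∀ i ω, |J i ω| ≤ 1) {k : ℕ} (hk : k ≤ n) :
    ∫ ω, (∑ i ∈ Finset.range k, J i ω * Y i ω) ^ 2 ∂μ
      = ∑ i ∈ Finset.range k, ∫ ω, J i ω ^ 2 * q i ω ∂μ := by
  induction k with
  | zero => simp
  | succ k ih =>
    have hkn : k < n := hk
    have hM := h.memLp_transform hJ hJ1 hkn.le
    have hD := h.memLp_mul hJ hJ1 hkn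
    have hY2 := (h.memLp k hkn).mono_exponent (q := 3) (p := 2) (by norm_num)
    have hJm := (hJ k).mono (ℱ.le k) le_rfl
    have hMJ : MemLp (fun ω => (∑ i ∈ Finset.range k, J i ω * Y i ω) * J k ω) 2 μ := by
      refine hM.mono (hM.1.mul hJm.aestronglyMeasurable) (ae_of_all _ fun ω => ?_)
      rw [norm_mul]
      exact mul_le_of_le_one_right (norm_nonneg _) (hJ1 k ω)
    have hcross : ∫ ω, (∑ i ∈ Finset.range k, J i ω * Y i ω) * J k ω * Y k ω ∂μ = 0 :=
      integral_mul_eq_zero (ℱ.le k)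
      ((h.measurable_transform hJ hkn.le).mul (hJ k)).stronglyMeasurable hMJ hY2
      (h.condExp_eq_zero k hkn)
    have hJ2 (ω) : |J k ω ^ 2| ≤ 1 := by
      rw [abs_pow]; exact pow_le_one₀ (abs_nonneg _) (hJ1 k ω)
    have hsq : ∫ ω, (J k ω * Y k ω) ^ 2 ∂μ = ∫ ω, J k ω ^ 2 * q k ω ∂μ := by
      simp_rw [mul_pow]
      rw [integral_mul_eq_of_bounded (ℱ.le k) ((hJ k).pow_const 2).stronglyMeasurable hJ2
        hY2.integrable_sq]
      refine integral_congr_ae ?_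
      filter_upwards [h.condExp_sq k hkn] with ω hω
      rw [hω]
    have hc : Integrable (fun ω => 2 * ((∑ i ∈ Finset.range k, J i ω * Y i ω) * J k ω * Y k ω))
      μ := (hMJ.integrable_mul hY2).const_mul 2
    have hMc : Integrable (fun ω => (∑ i ∈ Finset.range k, J i ω * Y i ω) ^ 2
      + 2 * ((∑ i ∈ Finset.range k, J i ω * Y i ω) * J k ω * Y k ω)) μ :=
      hM.integrable_sq.add hc
    rw [Finset.sum_range_succ, ← ih hkn.le, ← hsq]
    have e (ω) : (∑ i ∈ Finset.range (k + 1), J i ω * Y i ω) ^ 2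
        = (∑ i ∈ Finset.range k, J i ω * Y i ω) ^ 2
          + 2 * ((∑ i ∈ Finset.range k, J i ω * Y i ω) * J k ω * Y k ω)
          + (J k ω * Y k ω) ^ 2 := by
      rw [Finset.sum_range_succ]; ring
    simp_rw [e]
    rw [integral_add hMc hD.integrable_sq, integral_add hM.integrable_sq hc,
      integral_const_mul, hcross]
    ring

lemma integral_sum_sq (h : HasCondMoments μ ℱ Y q n B δ) :
    ∫ ω, (∑ i ∈ Finset.range n, Y i ω) ^ 2 ∂μ = ∫ ω, ∑ i ∈ Finset.range n, q i ω ∂μ := by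
  have := h.integral_transform_sq (J := fun _ _ => 1) (fun _ => measurable_const) (by simp) le_rfl
  rw [integral_finsetSum _ fun i _ => h.integrable_q i]
  simpa using this

/-- The Lindeberg bound for the stopped martingale. -/
lemma integral_gaussSmooth_stopped_le (h : HasCondMoments μ ℱ Y q n B δ) {f : ℝ → ℝ}
    (hf : LipschitzWith 1 f) (hδ : 0 ≤ δ) {c e : ℝ} (hc : 0 ≤ c) (he : 0 < e) :
    ∫ ω, gaussSmooth f (remainder c (fun j => q j ω) n + (e + B))
        (∑ i ∈ Finset.range n, stopInd c (fun j => q j ω) i * Y i ω) ∂μ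
      ≤ gaussSmooth f (c + (e + B)) 0 + 2 * δ * Real.log ((c + e) / e) := by
  obtain ⟨ω₀⟩ := nonempty_of_isProbabilityMeasure μ
  have hB : 0 ≤ B := (h.q_nonneg 0 ω₀).trans (h.q_le 0 ω₀)
  have hJ (i : ℕ) := h.measurable_stopInd c i
  have hJ1 (i : ℕ) (ω : Ω) : |stopInd c (fun j => q j ω) i| ≤ 1 := by
    rw [abs_of_nonneg (stopInd_nonneg _ _ _)]; exact stopInd_le_one _ _ _
  have hR (i : ℕ) := h.measurable_remainder c i
  have hR0 (i : ℕ) (ω : Ω) : 0 ≤ remainder c (fun j => q j ω) i :=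
    remainder_nonneg hc (fun j => h.q_nonneg j ω) i
  have hint (i : ℕ) : Integrable (fun ω => stopInd c (fun j => q j ω) i * q i ω
      / (remainder c (fun j => q j ω) (i + 1) + (e + B))) μ := by
    refine Integrable.of_bound (C := B / e) ((((hJ i).mul (h.q_meas i)).div
      ((hR i).add_const _)).mono (ℱ.le i) le_rfl).aestronglyMeasurable (ae_of_all _ fun ω => ?_)
    have h0 : 0 < remainder c (fun j => q j ω) (i + 1) + (e + B) := by linarith [hR0 (i + 1) ω]
    have h1 : 0 ≤ stopInd c (fun j => q j ω) i * q i ω :=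
      mul_nonneg (stopInd_nonneg _ _ _) (h.q_nonneg i ω)
    rw [Real.norm_eq_abs, abs_of_nonneg (div_nonneg h1 h0.le)]
    exact div_le_div₀ hB ((mul_le_of_le_one_left (h.q_nonneg i ω) (stopInd_le_one _ _ _)).trans
      (h.q_le i ω)) he (by linarith [hR0 (i + 1) ω])
  have main : ∀ k ≤ n, ∫ ω, gaussSmooth f (remainder c (fun j => q j ω) k + (e + B))
        (∑ i ∈ Finset.range k, stopInd c (fun j => q j ω) i * Y i ω) ∂μ
      ≤ gaussSmooth f (c + (e + B)) 0 + 2 * δ * ∫ ω, ∑ i ∈ Finset.range k,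
        stopInd c (fun j => q j ω) i * q i ω
          / (remainder c (fun j => q j ω) (i + 1) + (e + B)) ∂μ := by
    intro k
    induction k with
    | zero => intro _; simp [remainder_zero]
    | succ k ih =>
      intro hk
      have hkn : k < n := hk
      have hstep := integral_gaussSmooth_step_le (ℱ.le k) hf (α := e + B) (C := c) (by linarith)
        (h.memLp k hkn) (h.condExp_eq_zero k hkn) (h.condExp_sq k hkn)
        (h.condExp_cube_le k hkn) (h.q_meas k) (h.q_nonneg k) (h.q_le k)
        (h.measurable_transform hJ hkn.le)
        ((h.memLp_transform hJ hJ1 hkn.le).integrable one_le_two) (hR k) (hR0 (k + 1))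
        (fun ω => remainder_le (fun j => h.q_nonneg j ω) _) (hJ k)
        (fun ω => stopInd_eq_zero_or_one _ _ _)
      -- Restoring the variance of the step to `R_{k+1}` gives `R_k`, so the subtracted term is the
      -- one in the induction hypothesis.
      simp_rw [remainder_succ_add] at hstep
      simp_rw [Finset.sum_range_succ]
      rw [integral_add (integrable_finsetSum _ fun i _ => hint i) (hint k)]
      linarith [ih hkn.le]
  refine (main n le_rfl).trans ?_
  gcongr
  refine (integral_mono (integrable_finsetSum _ fun i _ => hint i)
    (integrable_const (Real.log ((c + e) / e))) fun ω => ?_).trans (by simp)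
  exact sum_div_remainder_le hc (fun j => h.q_nonneg j ω) (fun j => h.q_le j ω) he n

/-- Comparison of a martingale with a Gaussian variable of the same variance `c`. -/
theorem integral_sub_gaussSmooth_le (h : HasCondMoments μ ℱ Y q n B δ) {f : ℝ → ℝ}
    (hf : LipschitzWith 1 f) (hδ : 0 ≤ δ) {c e : ℝ} (hc : 0 ≤ c) (he : 0 < e)
    (hcq : ∫ ω, ∑ i ∈ Finset.range n, q i ω ∂μ = c) :
    ∫ ω, f (∑ i ∈ Finset.range n, Y i ω) ∂μ - gaussSmooth f c 0
      ≤ 2 * √((∫ ω, |∑ i ∈ Finset.range n, q i ω - c| ∂μ) / 2 + B) + 2 * √(e + B)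
        + 2 * δ * Real.log ((c + e) / e) := by
  obtain ⟨ω₀⟩ := nonempty_of_isProbabilityMeasure μ
  have hB : 0 ≤ B := (h.q_nonneg 0 ω₀).trans (h.q_le 0 ω₀)
  set J : ℕ → Ω → ℝ := fun i ω => stopInd c (fun j => q j ω) i with hJdef
  set R : Ω → ℝ := fun ω => remainder c (fun j => q j ω) n with hRdef
  set S : Ω → ℝ := fun ω => ∑ i ∈ Finset.range n, Y i ω with hS
  set S' : Ω → ℝ := fun ω => ∑ i ∈ Finset.range n, J i ω * Y i ω with hS'
  have hJ (i : ℕ) : Measurable[ℱ i] (J i) := h.measurable_stopInd c i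
  have hJ0 (i : ℕ) (ω : Ω) : 0 ≤ J i ω := stopInd_nonneg _ _ _
  have hJle (i : ℕ) (ω : Ω) : J i ω ≤ 1 := stopInd_le_one _ _ _
  have hJ1 (i : ℕ) (ω : Ω) : |J i ω| ≤ 1 := by
    rw [abs_of_nonneg (hJ0 i ω)]; exact hJle i ω
  have hR0 (ω : Ω) : 0 ≤ R ω := remainder_nonneg hc (fun j => h.q_nonneg j ω) n
  have hRc (ω : Ω) : R ω ≤ c := remainder_le (fun j => h.q_nonneg j ω) n
  have hRm : Measurable R := by
    refine Measurable.const_sub (Finset.measurable_fun_sum _ fun j hj => ?_) c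
    exact ((hJ j).mul (h.q_meas j)).mono (ℱ.le j) le_rfl
  have hRi : Integrable R μ := Integrable.of_bound hRm.aestronglyMeasurable c
    (ae_of_all _ fun ω => by simpa [abs_of_nonneg (hR0 ω)] using hRc ω)
  have hSp : MemLp S 2 μ := by
    simpa using h.memLp_transform (J := fun _ _ => 1) (fun _ => measurable_const) (by simp) le_rfl
  have hS'p : MemLp S' 2 μ := h.memLp_transform hJ hJ1 le_rfl
  have hQi : Integrable (fun ω => ∑ i ∈ Finset.range n, q i ω) μ :=
    integrable_finsetSum _ fun i _ => h.integrable_q i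
  have hJq (i : ℕ) : Integrable (fun ω => J i ω * q i ω) μ :=
    integrable_mul_of_bounded ((hJ i).mono (ℱ.le i) le_rfl).aestronglyMeasurable (hJ1 i)
      (h.integrable_q i)
  -- Orthogonality with multipliers `1 - J`, which equal their own squares. The discarded variance
  -- is `∑ q - ∑ J q`, whose mean is that of `R` because `∑ q` has mean `c`.
  have hdiff : ∫ ω, (S ω - S' ω) ^ 2 ∂μ = ∫ ω, R ω ∂μ := by
    have := h.integral_transform_sq (J := fun i ω => 1 - J i ω)
      (fun i => (hJ i).const_sub 1) (fun i ω => by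
        rw [abs_of_nonneg (sub_nonneg.2 (hJle i ω))]; linarith [hJ0 i ω]) le_rfl
    have e1 (ω) : S ω - S' ω = ∑ i ∈ Finset.range n, (1 - J i ω) * Y i ω := by
      rw [hS, hS', ← Finset.sum_sub_distrib]
      exact Finset.sum_congr rfl fun i _ => by ring
    have e2 (i : ℕ) : ∫ ω, (1 - J i ω) ^ 2 * q i ω ∂μ
        = ∫ ω, q i ω ∂μ - ∫ ω, J i ω * q i ω ∂μ := by
      rw [← integral_sub (h.integrable_q i) (hJq i)]
      congr 1 with ω
      rcases stopInd_eq_zero_or_one c (fun j => q j ω) i with h' | h' <;> simp [hJdef, h']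
    have e3 : ∫ ω, R ω ∂μ = c - ∑ i ∈ Finset.range n, ∫ ω, J i ω * q i ω ∂μ := by
      rw [← integral_finsetSum _ fun i _ => hJq i]
      simp only [hRdef, remainder]
      rw [integral_sub (integrable_const _) (integrable_finsetSum _ fun i _ => hJq i)]
      simp [hJdef]
    simp_rw [e1]
    rw [this, e3, Finset.sum_congr rfl fun i _ => e2 i, Finset.sum_sub_distrib, ← hcq,
      integral_finsetSum _ fun i _ => h.integrable_q i]
  have hA : ∫ ω, R ω ∂μ ≤ (∫ ω, |∑ i ∈ Finset.range n, q i ω - c| ∂μ) / 2 + B := by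
    have i1 : Integrable (fun ω => |∑ i ∈ Finset.range n, q i ω - c|) μ :=
      (hQi.sub (integrable_const c)).abs
    have i2 : Integrable (fun ω => c - ∑ i ∈ Finset.range n, q i ω) μ :=
      (integrable_const c).sub hQi
    have i3 : Integrable (fun ω => (|∑ i ∈ Finset.range n, q i ω - c|
      + (c - ∑ i ∈ Finset.range n, q i ω)) / 2) μ := (i1.add i2).div_const 2
    have := integral_mono hRi (i3.add (integrable_const B)) fun ω =>
      remainder_le_add hc (fun j => h.q_nonneg j ω) (fun j => h.q_le j ω) n
    simp only [Pi.add_apply] at this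
    rw [integral_add i3 (integrable_const B), integral_div, integral_add i1 i2, integral_sub (integrable_const c) hQi, hcq] at this
    simpa using this
  set A := √((∫ ω, |∑ i ∈ Finset.range n, q i ω - c| ∂μ) / 2 + B) with hAdef
  have fS : Integrable (fun ω => f (S ω)) μ := by
    simpa [gaussSmooth_zero] using integrable_gaussSmooth hf (T := fun _ => 0) (C := 0)
      measurable_const (fun _ => le_rfl) (hSp.integrable one_le_two)
  have fS' : Integrable (fun ω => f (S' ω)) μ := by
    simpa [gaussSmooth_zero] using integrable_gaussSmooth hf (T := fun _ => 0) (C := 0)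
      measurable_const (fun _ => le_rfl) (hS'p.integrable one_le_two)
  have gS' : Integrable (fun ω => gaussSmooth f (R ω + (e + B)) (S' ω)) μ :=
    integrable_gaussSmooth hf (C := c + (e + B)) (hRm.add_const _)
      (fun ω => by linarith [hRc ω]) (hS'p.integrable one_le_two)
  have hi1 : ∫ ω, f (S ω) ∂μ - ∫ ω, f (S' ω) ∂μ ≤ A := by
    rw [← integral_sub fS fS']
    refine (integral_mono (fS.sub fS') (((hSp.sub hS'p).integrable one_le_two).abs)
      fun ω => ?_).trans ((integral_abs_le_sqrt (hSp.sub hS'p)).trans ?_)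
    · have := abs_le_of_lipschitz hf (S ω) (S' ω)
      rw [NNReal.coe_one, one_mul] at this
      exact (le_abs_self _).trans this
    · simp only [Pi.sub_apply]
      rw [hdiff]
      exact Real.sqrt_le_sqrt hA
  have hsqR : MemLp (fun ω => √(R ω)) 2 μ := by
    refine MemLp.of_bound hRm.sqrt.aestronglyMeasurable √c (ae_of_all _ fun ω => ?_)
    rw [Real.norm_eq_abs, abs_of_nonneg (Real.sqrt_nonneg _)]
    exact Real.sqrt_le_sqrt (hRc ω)
  -- Removing the smoothing costs its standard deviation, at most `√R + √(e + B)`, and `E √R ≤ √(E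
  -- R)`.
  have hi2 : ∫ ω, f (S' ω) ∂μ - ∫ ω, gaussSmooth f (R ω + (e + B)) (S' ω) ∂μ
      ≤ A + √(e + B) := by
    rw [← integral_sub fS' gS']
    have hsi := hsqR.integrable one_le_two
    refine (integral_mono (fS'.sub gS') (hsi.add (integrable_const √(e + B)))
      fun ω => ?_).trans ?_
    · have := abs_gaussSmooth_sub_le hf 0 (R ω + (e + B)) (S' ω) (S' ω)
      rw [gaussSmooth_zero, sub_self, abs_zero, zero_add, Real.sqrt_zero, zero_sub, abs_neg,
        abs_of_nonneg (Real.sqrt_nonneg _)] at this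
      exact (le_abs_self _).trans (this.trans (sqrt_add_le_add_sqrt (hR0 ω) (by linarith)))
    · simp only [Pi.add_apply]
      rw [integral_add hsi (integrable_const _)]
      have h1 := integral_abs_le_sqrt hsqR
      simp_rw [abs_of_nonneg (Real.sqrt_nonneg _), Real.sq_sqrt (hR0 _)] at h1
      have h2 := h1.trans (Real.sqrt_le_sqrt hA)
      simpa using h2
  have hi3 := h.integral_gaussSmooth_stopped_le hf hδ hc he
  have hi4 : gaussSmooth f (c + (e + B)) 0 - gaussSmooth f c 0 ≤ √(e + B) := by
    have := abs_gaussSmooth_sub_le hf (c + (e + B)) c 0 0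
    rw [sub_self, abs_zero, zero_add, abs_of_nonneg (sub_nonneg.2 (Real.sqrt_le_sqrt
      (by linarith)))] at this
    have h2 := sqrt_add_le_add_sqrt (x := c) (y := e + B) hc (by linarith)
    linarith [le_abs_self (gaussSmooth f (c + (e + B)) 0 - gaussSmooth f c 0)]
  have hi3' : ∫ ω, gaussSmooth f (R ω + (e + B)) (S' ω) ∂μ
      ≤ gaussSmooth f (c + (e + B)) 0 + 2 * δ * Real.log ((c + e) / e) := hi3
  linarith

end HasCondMoments

end MartingaleCLT

/-! ### Constants, rescaling and the conclusion. -/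

namespace MartingaleCLT

lemma error_terms_le {s b D ε : ℝ} {n : ℕ} (hn : 1 ≤ n) (hs : 0 < s) (hb : 0 ≤ b)
    (hε : 0 ≤ ε) (hD : 1.6 * b ≤ D) (hsb : s ^ 2 ≤ n * b ^ 2) :
    (2 * √(ε / 2 + b ^ 2) + 2 * √(s ^ 2 / n + b ^ 2)
        + 2 * D * Real.log ((s ^ 2 + s ^ 2 / n) / (s ^ 2 / n))) / s
      ≤ 1.5 * √(ε / s ^ 2)
        + 3 * n * D * (s ^ 2 / n + 1.4 * b ^ 2) * (1 + Real.log n) / s ^ 3 + 2 / √(n : ℝ) := by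
  have hn1 : (1 : ℝ) ≤ n := by exact_mod_cast hn
  have hn0 : (0 : ℝ) < n := by linarith
  have hD0 : 0 ≤ D := by linarith
  have hlog0 : 0 ≤ Real.log n := Real.log_nonneg hn1
  have hlog : Real.log ((s ^ 2 + s ^ 2 / n) / (s ^ 2 / n)) ≤ 1 + Real.log n := by
    rw [show (s ^ 2 + s ^ 2 / n) / (s ^ 2 / n) = n + 1 by field_simp]
    rw [Real.log_le_iff_le_exp (by positivity), Real.exp_add, Real.exp_log hn0]
    have : (2 : ℝ) ≤ Real.exp 1 := by linarith [Real.add_one_le_exp (1 : ℝ)]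
    nlinarith
  -- The constant `1.5` is `2 * 0.75`, where `0.75 ^ 2 ≥ 1 / 2`.
  have h1 : √(ε / 2 + b ^ 2) ≤ 0.75 * √ε + b := by
    refine (sqrt_add_le_add_sqrt (by positivity) (by positivity)).trans ?_
    rw [Real.sqrt_sq hb]
    gcongr
    refine Real.sqrt_le_iff.2 ⟨by positivity, ?_⟩
    rw [mul_pow, Real.sq_sqrt hε]
    linarith
  have h2 : √(s ^ 2 / n + b ^ 2) ≤ s / √(n : ℝ) + b := by
    refine (sqrt_add_le_add_sqrt (by positivity) (by positivity)).trans ?_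
    rw [Real.sqrt_sq hb, Real.sqrt_div (by positivity), Real.sqrt_sq hs.le]
  have e1 : √(ε / s ^ 2) = √ε / s := by rw [Real.sqrt_div hε, Real.sqrt_sq hs.le]
  -- The hypothesis `s ^ 2 ≤ n * b ^ 2` turns `s ^ 2 + 1.4 * n * b ^ 2` into at least `2.4 * s ^ 2`,
  -- and `7.2 = 3 * 2.4`.
  have h3 : 7.2 * D * (1 + Real.log n) / s
      ≤ 3 * n * D * (s ^ 2 / n + 1.4 * b ^ 2) * (1 + Real.log n) / s ^ 3 := by
    have h4 : 2.4 * s ^ 2 ≤ n * (s ^ 2 / n + 1.4 * b ^ 2) := by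
      rw [mul_add, mul_div_cancel₀ _ hn0.ne']
      linarith
    rw [div_le_div_iff₀ hs (by positivity)]
    have h5 : 0 ≤ 3 * D * (1 + Real.log n) * s := by positivity
    nlinarith [mul_le_mul_of_nonneg_left h4 h5]
  have h6 : D ≤ D * (1 + Real.log n) := le_mul_of_one_le_right hD0 (by linarith)
  have h7 : D * Real.log ((s ^ 2 + s ^ 2 / n) / (s ^ 2 / n)) ≤ D * (1 + Real.log n) := by
    gcongr
  -- The four copies of `b` are at most `2.5 * D`, the logarithm adds `2 * D * (1 + log n)`, and
  -- `4.5 ≤ 7.2`.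
  calc _ ≤ (1.5 * √ε + 2 * (s / √(n : ℝ)) + 7.2 * D * (1 + Real.log n)) / s := by
        refine div_le_div_of_nonneg_right ?_ hs.le
        linarith
    _ = 1.5 * (√ε / s) + 7.2 * D * (1 + Real.log n) / s + 2 / √(n : ℝ) := by
        field_simp
        ring
    _ ≤ _ := by rw [e1]; linarith

/-- The class of `1`-Lipschitz functions is closed under `g ↦ -g`, so a one-sided bound suffices. -/
lemma wassersteinDist_le_ofReal {P Q : Measure ℝ} {R : ℝ}
    (h : ∀ g : ℝ → ℝ, LipschitzWith 1 g → ∫ x, g x ∂P - ∫ x, g x ∂Q ≤ R) :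
    wassersteinDist P Q ≤ ENNReal.ofReal R := by
  refine iSup₂_le fun g hg => ENNReal.ofReal_le_ofReal (abs_le'.2 ⟨h g hg, ?_⟩)
  have := h (fun x => -g x) hg.neg
  rw [integral_neg, integral_neg] at this
  linarith

lemma lipschitzWith_rescale {g : ℝ → ℝ} (hg : LipschitzWith 1 g) {s : ℝ} (hs : 0 < s) :
    LipschitzWith 1 (fun x => s * g (x / s)) := by
  refine LipschitzWith.of_dist_le_mul fun x y => ?_
  have := abs_le_of_lipschitz hg (x / s) (y / s)
  rw [← sub_div, abs_div, abs_of_pos hs, NNReal.coe_one, one_mul] at this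
  rw [Real.dist_eq, Real.dist_eq, ← mul_sub, abs_mul, abs_of_pos hs, NNReal.coe_one, one_mul]
  calc s * |g (x / s) - g (y / s)| ≤ s * (|x - y| / s) := by gcongr
    _ = |x - y| := by field_simp

lemma integral_gaussian_eq_rescale (g : ℝ → ℝ) {s : ℝ} (hs : 0 < s) :
    ∫ x, g x ∂(gaussianReal 0 1) = gaussSmooth (fun x => s * g (x / s)) (s ^ 2) 0 / s := by
  rw [gaussSmooth, Real.sqrt_sq hs.le, integral_const_mul, mul_div_cancel_left₀ _ hs.ne']
  simp [hs.ne']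

lemma sum_Icc_one_eq (a : ℕ → ℝ) (n : ℕ) :
    ∑ k ∈ Finset.Icc 1 n, a k = ∑ i ∈ Finset.range n, a (i + 1) := by
  rw [Finset.range_eq_Ico, Finset.sum_Ico_add' a 0 n 1]
  congr 1

end MartingaleCLT

open MartingaleCLT in
theorem corollary3 {Ω : Type*} {m0 : MeasurableSpace Ω} (μ : Measure Ω) [IsProbabilityMeasure μ]
    (ℱ : Filtration ℕ m0) (X : ℕ → Ω → ℝ) (n : ℕ) (β δ : ℝ)
    (hX : MartingaleCLT.IsMartingaleDiffSeq X ℱ μ n)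
    (hs : 0 < MartingaleCLT.stdDev X μ n)
    (hX3 : ∀ k ∈ Finset.Icc 1 n, MemLp (X k) 3 μ)
    (hcond : ∀ k ∈ Finset.Icc 1 n, ∀ᵐ ω ∂μ,
      (μ[fun ω' => |X k ω'| ^ 3 | ℱ (k - 1)]) ω ≤ min β (δ * MartingaleCLT.sigmaSq X ℱ μ k ω)) :
    MartingaleCLT.wassersteinDist
        (μ.map (fun ω => MartingaleCLT.partialSum X n ω / MartingaleCLT.stdDev X μ n))
        (gaussianReal 0 1)
      ≤ ENNReal.ofReal
        (1.5 * (∫ ω, |MartingaleCLT.VSq X ℱ μ n ω / MartingaleCLT.stdDev X μ n ^ 2 - 1| ∂μ)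
              ^ (1 / 2 : ℝ)
          + 3 * n * max (1.6 * β ^ (1 / 3 : ℝ)) δ
              * (MartingaleCLT.stdDev X μ n ^ 2 / n + 1.4 * β ^ (2 / 3 : ℝ)) * (1 + Real.log n)
              / MartingaleCLT.stdDev X μ n ^ 3
          + 2 / √(n : ℝ)) := by
  have hn : 1 ≤ n := by
    by_contra h0
    obtain rfl : n = 0 := by omega
    have : partialSum X 0 = 0 := by ext; simp [partialSum]
    simp [stdDev, this] at hs
  have hmem {i : ℕ} (hi : i < n) : i + 1 ∈ Finset.Icc 1 n := by
    rw [Finset.mem_Icc]; omega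
  have hβ : 0 ≤ β := by
    have h0 : 0 ≤ᵐ[μ] μ[fun ω' => |X 1 ω'| ^ 3 | ℱ (1 - 1)] :=
      condExp_nonneg (ae_of_all _ fun ω => by positivity)
    obtain ⟨ω, h1, h2⟩ := (h0.and (hcond 1 (hmem hn))).exists
    exact (h1.trans h2).trans (min_le_left _ _)
  set s := stdDev X μ n with hsdef
  set b := β ^ (1 / 3 : ℝ) with hbdef
  have hb : 0 ≤ b := Real.rpow_nonneg hβ _
  have hb2 : β ^ (2 / 3 : ℝ) = b ^ 2 := by
    rw [hbdef, ← Real.rpow_mul_natCast hβ]; norm_num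
  have hb3 : b ^ 3 = β := by
    rw [hbdef, ← Real.rpow_mul_natCast hβ]; norm_num
  -- Replacing `δ` by `D` keeps the moment condition, makes the constant nonnegative and lets it
  -- absorb multiples of `b`.
  set D := max (1.6 * b) δ with hDdef
  have hD : 1.6 * b ≤ D := le_max_left _ _
  have hD0 : 0 ≤ D := le_trans (by positivity) hD
  set Y : ℕ → Ω → ℝ := fun i => X (i + 1) with hY
  -- The truncation makes `0 ≤ q ≤ b ^ 2` hold everywhere and for every index, as the pathwise
  -- stopping estimates require. For `i < n` it changes `σ²` only on a null set, since `σ³ ≤ β = b ^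
  -- 3` almost surely.
  set q : ℕ → Ω → ℝ := fun i ω => min (max (sigmaSq X ℱ μ (i + 1) ω) 0) (b ^ 2) with hq
  have hq0 (i : ℕ) (ω : Ω) : 0 ≤ q i ω := le_min (le_max_right _ _) (by positivity)
  have hσq {i : ℕ} (hi : i < n) : sigmaSq X ℱ μ (i + 1) =ᵐ[μ] q i := by
    have h0 : 0 ≤ᵐ[μ] sigmaSq X ℱ μ (i + 1) :=
      condExp_nonneg (ae_of_all _ fun ω => sq_nonneg _)
    have h1 := sqrt_cube_condExp_le (ℱ.le (i + 1 - 1)) (hX3 _ (hmem hi))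
    filter_upwards [h0, h1, hcond _ (hmem hi)] with ω h0 h1 h2
    have h3 : √(sigmaSq X ℱ μ (i + 1) ω) ^ 3 ≤ b ^ 3 := by
      rw [hb3]; exact h1.trans (h2.trans (min_le_left _ _))
    have h4 : √(sigmaSq X ℱ μ (i + 1) ω) ≤ b := le_of_pow_le_pow_left₀ (by norm_num) hb h3
    have h5 : sigmaSq X ℱ μ (i + 1) ω ≤ b ^ 2 := (Real.sqrt_le_left hb).1 h4
    simp only [hq]
    rw [max_eq_left (show (0 : ℝ) ≤ _ from h0), min_eq_left h5]
  have H : HasCondMoments μ ℱ Y q n (b ^ 2) D :=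
    { meas := fun i hi => hX.adapted _ (hmem hi)
      memLp := fun i hi => hX3 _ (hmem hi)
      condExp_eq_zero := fun i hi => hX.condExp_eq_zero _ (hmem hi)
      condExp_sq := fun i hi => hσq hi
      condExp_cube_le := fun i hi => by
        filter_upwards [hcond _ (hmem hi), hσq hi] with ω h1 h2
        rw [h2] at h1
        exact (h1.trans (min_le_right _ _)).trans
          (mul_le_mul_of_nonneg_right (le_max_right _ _) (hq0 i ω))
      q_meas := fun i => (stronglyMeasurable_condExp.measurable.max measurable_const).min
        measurable_const
      q_nonneg := hq0
      q_le := fun i ω => min_le_right _ _ }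
  have hS (ω : Ω) : partialSum X n ω = ∑ i ∈ Finset.range n, Y i ω := sum_Icc_one_eq _ n
  have hSp : MemLp (partialSum X n) 2 μ := by
    rw [funext hS]
    exact memLp_finsetSum _ fun i hi => (H.memLp i (Finset.mem_range.1 hi)).mono_exponent
      (by norm_num)
  have hc : ∫ ω, ∑ i ∈ Finset.range n, q i ω ∂μ = s ^ 2 := by
    have h0 : ∫ ω, partialSum X n ω ∂μ = 0 := by
      simp only [partialSum]
      rw [integral_finsetSum _ hX.integrable]
      refine Finset.sum_eq_zero fun k hk => ?_
      rw [← integral_condExp (ℱ.le (k - 1)), integral_congr_ae (hX.condExp_eq_zero k hk)]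
      simp
    rw [hsdef, stdDev, Real.sq_sqrt (variance_nonneg _ _), variance_eq_sub hSp, h0,
      ← H.integral_sum_sq]
    simp [hS]
  have hsb : s ^ 2 ≤ n * b ^ 2 := by
    rw [← hc]
    refine (integral_mono (integrable_finsetSum _ fun i _ => H.integrable_q i)
      (integrable_const (n * b ^ 2)) fun ω => ?_).trans (by simp)
    refine (Finset.sum_le_sum fun i _ => H.q_le i ω).trans (by simp)
  have hV : ∫ ω, |VSq X ℱ μ n ω / s ^ 2 - 1| ∂μ
      = (∫ ω, |∑ i ∈ Finset.range n, q i ω - s ^ 2| ∂μ) / s ^ 2 := by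
    rw [← integral_div]
    refine integral_congr_ae ?_
    have hall : ∀ᵐ ω ∂μ, ∀ i ∈ Finset.range n, sigmaSq X ℱ μ (i + 1) ω = q i ω :=
      (Filter.eventually_all_finset _).2 fun i hi => hσq (Finset.mem_range.1 hi)
    filter_upwards [hall] with ω hω
    have e : VSq X ℱ μ n ω = ∑ i ∈ Finset.range n, q i ω :=
      (sum_Icc_one_eq _ n).trans (Finset.sum_congr rfl hω)
    rw [e, div_sub_one (by positivity), abs_div, abs_of_pos (by positivity : 0 < s ^ 2)]
  rw [hV, hb2, ← Real.sqrt_eq_rpow]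
  refine wassersteinDist_le_ofReal fun g hg => ?_
  have hn0 : (0 : ℝ) < n := by exact_mod_cast hn
  refine le_trans ?_ (error_terms_le (D := D) hn hs hb
    (integral_nonneg fun ω => abs_nonneg _) hD hsb)
  -- With `e = s ^ 2 / n` the logarithm becomes `log (n + 1)`, and `2 * √e / s` is the term `2 /
  -- √n`.
  have hcore := H.integral_sub_gaussSmooth_le (lipschitzWith_rescale hg hs) hD0
    (sq_nonneg s) (e := s ^ 2 / n) (by positivity) hc
  have hmap : ∫ x, g x ∂(μ.map (fun ω => partialSum X n ω / s))
      = (∫ ω, s * g ((∑ i ∈ Finset.range n, Y i ω) / s) ∂μ) / s := by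
    rw [integral_map (hSp.1.aemeasurable.div_const s) hg.continuous.aestronglyMeasurable,
      integral_const_mul, mul_div_cancel_left₀ _ hs.ne']
    simp only [hS]
  rw [hmap, integral_gaussian_eq_rescale g hs, ← sub_div]
  gcongr
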